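/- **Notation.** Let $\mathbb H$ be the real quaternions, $A^*$ the conjugate transpose, and $\operatorname{rk}$ the rank of a quaternion matrix (the dimension of its left row space). For square $B$, $\operatorname{Ind}B$ is the smallest positive integer $k$ with $\operatorname{rk}(B^{k+1})=\operatorname{rk}(B^k)$. For an $n\times n$ quaternion matrix $B=(b_{ij})$ and an index $i$, the row determinant is $$\operatorname{rdet}_i B=\sum_{\sigma\in S_n}(-1)^{n-\rho}\,\prod_{t=1}^{\rho}\bigl(b_{x_t\,\sigma(x_t)}\,b_{\sigma(x_t)\,\sigma^2(x_t)}\cdots b_{\sigma^{l_t-1}(x_t)\,x_t}\bigr)\quad\text{(factors ordered from left to right)},$$ where $\rho$ is the number of cycles of $\sigma$ (fixed points included), $x_1=i$, and $x_2<\dots<x_\rho$ are the least elements of the cycles not containing $i$, the cycle of $x_t$ having length $l_t$. The column determinant $\operatorname{cdet}_j B$ is defined in the same way with $x_1=j$, with the cycle factors $\bigl(b_{x_t\,\sigma^{l_t-1}(x_t)}\cdots b_{\sigma^2(x_t)\,\sigma(x_t)}\,b_{\sigma(x_t)\,x_t}\bigr)$ multiplied from right to left for $t=1,\dots,\rho$.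 For Hermitian $B$ all row and column determinants coincide and are real; their common value is $\det B$, with $\det=1$ for the empty matrix. $B_{i.}(b)$ and $B_{.j}(c)$ are $B$ with its $i$-th row replaced by the row $b$, respectively its $j$-th column replaced by the column $c$; $B_\alpha^\alpha$ is the principal submatrix on the index set $\alpha$, and $|B|_\alpha^\alpha=\det B_\alpha^\alpha$ for Hermitian $B$. $I_{r,m}=J_{r,m}$ is the set of $r$-element subsets of $\{1,\dots,m\}$, and $I_{r,m}\{j\}=J_{r,m}\{j\}$ the set of those that contain $j$. In the sums below, a row or column position inside a principal submatrix is named by its original index. For a matrix denoted by a capital letter, the lower-case letter with subscript $i.$ or $.j$ is its $i$-th row or $j$-th column. **Generalized inverses.** Let $A\in\mathbb H^{m\times n}$ and $W\in\mathbb H^{n\times m}$. The Moore–Penrose inverse $A^\dagger$ is the unique $X$ with $AXA=A$, $XAX=X$, $(AX)^*=AX$, $(XA)^*=XA$. The $W$-weighted Drazin inverse $A^{d,W}$ is the unique $X$ with $(AW)^{l+1}XW=(AW)^{l}$, $XWAWX=X$, $AWX=XWA$, where $l=\operatorname{Ind}(AW)$. The weighted CMP inverse is $$A^{c,\dagger,W}=A^\dagger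 A\,W A^{d,W}W\,A A^\dagger=(a^{c,\dagger,W}_{ij})\in\mathbb H^{n\times m}.$$ **Theorem.** Let $A\in\mathbb H^{m\times n}$ have rank $r$, let $W\in\mathbb H^{n\times m}$ be nonzero, and let $k=\max\{\operatorname{Ind}(WA),\operatorname{Ind}(AW)\}$. Then $A^\dagger$ and $A^{d,W}$ exist and are unique, and the following hold. (i) If $WA$ is Hermitian and $\operatorname{rk}(WA)^k=r_1$, then for all $i\in\{1,\dots,n\}$, $j\in\{1,\dots,m\}$, $$a^{c,\dagger,W}_{ij}=\frac{\sum_{\alpha\in I_{r,m}\{j\}}\operatorname{rdet}_j\bigl((AA^*)_{j.}(\widetilde\omega_{i.})\bigr)_\alpha^\alpha}{\Bigl(\sum_{\beta\in J_{r,n}}|A^*A|_\beta^\beta\Bigr)^2\sum_{\alpha\in I_{r_1,n}}\bigl|(WA)^{k+2}\bigr|_\alpha^\alpha},$$ where $\widetilde\Omega=\Omega WAA^*$; $\Omega=(\omega_{is})\in\mathbb H^{n\times n}$ has the entries $\omega_{is}=\sum_{\alpha\in I_{r_1,n}\{s\}}\operatorname{rdet}_s\bigl((WA)^{k+2}_{s.}(\phi^{(1)}_{i.})\bigr)_\alpha^\alpha$;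 $\phi^{(1)}_{i.}$ is the $i$-th row of $\Phi_1=\Phi A(WA)^k$; $\Phi=(\phi_{it})\in\mathbb H^{n\times m}$ has the entries $\phi_{it}=\sum_{\beta\in J_{r,n}\{i\}}\operatorname{cdet}_i\bigl((A^*A)_{.i}(w^{(1)}_{.t})\bigr)_\beta^\beta$; and $w^{(1)}_{.t}$ is the $t$-th column of $W_1=A^*AW$. (ii) If $AW$ is Hermitian and $\operatorname{rk}(AW)^k=r_1$, then for all $i\in\{1,\dots,n\}$, $j\in\{1,\dots,m\}$, $$a^{c,\dagger,W}_{ij}=\frac{\sum_{\beta\in J_{r,n}\{i\}}\operatorname{cdet}_i\bigl((A^*A)_{.i}(\widetilde\upsilon_{.j})\bigr)_\beta^\beta}{\Bigl(\sum_{\alpha\in I_{r,m}}|AA^*|_\alpha^\alpha\Bigr)^2\sum_{\beta\in J_{r_1,m}}\bigl|(AW)^{k+2}\bigr|_\beta^\beta},$$ where $\widetilde\Upsilon=A^*AW\Upsilon$; $\Upsilon=(\upsilon_{tj})\in\mathbb H^{m\times m}$ has the entries $\upsilon_{tj}=\sum_{\beta\in J_{r_1,m}\{t\}}\operatorname{cdet}_t\bigl((AW)^{k+2}_{.t}(\psi^{(1)}_{.j})\bigr)_\beta^\beta$;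 $\psi^{(1)}_{.j}$ is the $j$-th column of $\Psi^{(1)}=(AW)^kA\Psi$; $\Psi=(\psi_{sj})\in\mathbb H^{n\times m}$ has the entries $\psi_{sj}=\sum_{\alpha\in I_{r,m}\{j\}}\operatorname{rdet}_j\bigl((AA^*)_{j.}(w^{(2)}_{s.})\bigr)_\alpha^\alpha$; and $w^{(2)}_{s.}$ is the $s$-th row of $W_2=WAA^*$. In both cases each sum of principal minors in the denominator is nonzero. -/

import Mathlib

namespace QuatMat

section RowColumnDeterminants

variable {ι R : Type*} [Fintype ι] [LinearOrder ι] [Ring R]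

/-- The first elements of the cycles of `σ` (fixed points are cycles of length one), listed in the
order in which the row and column determinants along `i` use them: first `i`, then, in increasing
order, the minimal elements of the cycles that do not contain `i`. -/
def leaders (σ : Equiv.Perm ι) (i : ι) : List ι :=
  i :: (Finset.univ.filter fun x : ι =>
    ¬ σ.SameCycle i x ∧ ∀ y : ι, σ.SameCycle x y → x ≤ y).sort

/-- The product `a_{x,σx} a_{σx,σ²x} ⋯ a_{σ^{l-1}x,x}` along the cycle of `x`, of length `l`. -/
noncomputable def rowCycle (A : Matrix ι ι R) (σ : Equiv.Perm ι) (x : ι) : R :=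
  ((List.range (Function.minimalPeriod σ x)).map fun t =>
    A ((σ ^ t) x) ((σ ^ (t + 1)) x)).prod

/-- The product `a_{x,σ^{l-1}x} ⋯ a_{σ²x,σx} a_{σx,x}` along the cycle of `x`, of length `l`. -/
noncomputable def colCycle (A : Matrix ι ι R) (σ : Equiv.Perm ι) (x : ι) : R :=
  ((List.range (Function.minimalPeriod σ x)).reverse.map fun t =>
    A ((σ ^ (t + 1)) x) ((σ ^ t) x)).prod

/-- The row determinant of `A` along the row `i`: the cycle factors of `σ` are multiplied from left
to right, beginning with the cycle of `i`; the sign is `(-1)^(n - r)` with `r` the number of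
cycles. -/
noncomputable def rdet (A : Matrix ι ι R) (i : ι) : R :=
  ∑ σ : Equiv.Perm ι, (-1) ^ (Fintype.card ι - (leaders σ i).length) *
    ((leaders σ i).map (rowCycle A σ)).prod

/-- The column determinant of `A` along the column `j`: the cycle factors of `σ` are multiplied
from right to left, beginning with the cycle of `j`. -/
noncomputable def cdet (A : Matrix ι ι R) (j : ι) : R :=
  ∑ σ : Equiv.Perm ι, (-1) ^ (Fintype.card ι - (leaders σ j).length) *
    ((leaders σ j).reverse.map (colCycle A σ)).prod

open Classical in
/-- The determinant of a Hermitian quaternion matrix. All its row and column determinants coincide;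
the row determinant along the first row is used here. The empty matrix has determinant `1`. -/
noncomputable def hdet (A : Matrix ι ι R) : R :=
  if h : Nonempty ι then rdet A (Finset.univ.min' (Finset.univ_nonempty_iff.mpr h)) else 1

end RowColumnDeterminants

section PrincipalMinors

variable {m n : ℕ} {R : Type*} [Ring R]

/-- The principal submatrix with rows and columns indexed by `α`. -/
def principal (A : Matrix (Fin n) (Fin n) R) (α : Finset (Fin n)) : Matrix α α R :=
  A.submatrix Subtype.val Subtype.val

/-- The sum of the principal minors of size `r` of a Hermitian matrix `H`. -/
noncomputable def minorSum (H : Matrix (Fin n) (Fin n) R) (r : ℕ) : R :=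
  ∑ α : {α : Finset (Fin n) // α.card = r}, hdet (principal H α.1)

/-- The matrix whose `(i, j)` entry is `∑_β cdet_i ((H_{.i}(c_{.j}))_β^β)`, the sum being over the
`β` of size `r` that contain `i`: the `i`-th column of `H` is replaced by the `j`-th column of
`C`. -/
noncomputable def cdetSums (H : Matrix (Fin n) (Fin n) R) (r : ℕ) (C : Matrix (Fin n) (Fin m) R) :
    Matrix (Fin n) (Fin m) R :=
  Matrix.of fun i j => ∑ β : {β : Finset (Fin n) // β.card = r ∧ i ∈ β},
    cdet (principal (H.updateCol i fun l => C l j) β.1) ⟨i, β.2.2⟩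

/-- The matrix whose `(i, j)` entry is `∑_α rdet_j ((H_{j.}(b_{i.}))_α^α)`, the sum being over the
`α` of size `r` that contain `j`: the `j`-th row of `H` is replaced by the `i`-th row of `B`. -/
noncomputable def rdetSums (H : Matrix (Fin n) (Fin n) R) (r : ℕ) (B : Matrix (Fin m) (Fin n) R) :
    Matrix (Fin m) (Fin n) R :=
  Matrix.of fun i j => ∑ α : {α : Finset (Fin n) // α.card = r ∧ j ∈ α},
    rdet (principal (H.updateRow j fun l => B i l) α.1) ⟨j, α.2.2⟩

end PrincipalMinors

section GeneralizedInverses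

variable {m n : ℕ}

/-- The rank of a quaternion matrix: the dimension of its left row space. -/
noncomputable def rk (A : Matrix (Fin m) (Fin n) (Quaternion ℝ)) : ℕ :=
  Module.finrank (Quaternion ℝ) (Submodule.span (Quaternion ℝ) (Set.range fun i => A i))

/-- The index of a square matrix: the smallest positive `k` with `rk (A^(k+1)) = rk (A^k)`. -/
noncomputable def ind (A : Matrix (Fin n) (Fin n) (Quaternion ℝ)) : ℕ :=
  sInf {k : ℕ | 0 < k ∧ rk (A ^ (k + 1)) = rk (A ^ k)}

/-- `X` satisfies the four Penrose equations for `A`. -/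
def IsMoorePenrose (A : Matrix (Fin m) (Fin n) (Quaternion ℝ))
    (X : Matrix (Fin n) (Fin m) (Quaternion ℝ)) : Prop :=
  A * X * A = A ∧ X * A * X = X ∧ (A * X).conjTranspose = A * X ∧ (X * A).conjTranspose = X * A

/-- `X` satisfies the equations of the `W`-weighted Drazin inverse of `A`. -/
def IsWeightedDrazin (A : Matrix (Fin m) (Fin n) (Quaternion ℝ))
    (W : Matrix (Fin n) (Fin m) (Quaternion ℝ))
    (X : Matrix (Fin m) (Fin n) (Quaternion ℝ)) : Prop :=
  (A * W) ^ (ind (A * W) + 1) * X * W = (A * W) ^ ind (A * W) ∧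
    X * W * A * W * X = X ∧ A * W * X = X * W * A

open Classical in
/-- The Moore-Penrose inverse. -/
noncomputable def mpInv (A : Matrix (Fin m) (Fin n) (Quaternion ℝ)) :
    Matrix (Fin n) (Fin m) (Quaternion ℝ) :=
  if h : ∃ X, IsMoorePenrose A X then h.choose else 0

open Classical in
/-- The `W`-weighted Drazin inverse. -/
noncomputable def wDrazin (A : Matrix (Fin m) (Fin n) (Quaternion ℝ))
    (W : Matrix (Fin n) (Fin m) (Quaternion ℝ)) : Matrix (Fin m) (Fin n) (Quaternion ℝ) :=
  if h : ∃ X, IsWeightedDrazin A W X then h.choose else 0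

/-- The weighted CMP inverse. -/
noncomputable def wcmp (A : Matrix (Fin m) (Fin n) (Quaternion ℝ))
    (W : Matrix (Fin n) (Fin m) (Quaternion ℝ)) : Matrix (Fin n) (Fin m) (Quaternion ℝ) :=
  mpInv A * A * W * wDrazin A W * W * A * mpInv A

end GeneralizedInverses

end QuatMat

open QuatMat
open scoped Matrix

/-! Replacing a row makes a row determinant a linear form in the new row, with cofactors as right
coefficients. So every sum of determinants in the theorem is a matrix product. Write M_s for `cofSum
H s`, the sum of the cofactor matrices of all principal submatrices of size s, and d_s for `minorSum
H s`. Then `rdetSums H s B` is B M_s, and for Hermitian H, by taking adjoints, `cdetSums H s C` is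
M_s C.

For Hermitian H the cofactors behave as over a field (`cofactorLaws`): H times the cofactor matrix
is a real scalar matrix. Summation over principal submatrices gives the Faddeev–LeVerrier recursion
H M_s + M_{s+1} = d_s I (`mul_cofSum_add`) and tr(H M_s) = s d_s (`trace_mul_cofSum`). From these,
d_q ≠ 0 and H M_{q+1} = 0 at q = rk H, so that d_q⁻¹ H M_q is an idempotent E with HE = H = EH. For
H = A*A it is A†A, for H = AA* it is AA†. For the Hermitian powers (WA)^(k+2) and (AW)^(k+2) it is W
A^{d,W} W A and A W A^{d,W} W respectively.

The numerators in (i) and (ii) are therefore products in which the two Gram matrices meet their own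
cofactor sums and give d_r A†A and d_r AA†, while the power of WA or AW meets its cofactor sum and
gives a multiple of the Drazin idempotent. What remains is the weighted CMP inverse times a nonzero
real number, the denominator. -/

namespace QuatMat

set_option linter.unusedSectionVars false

/-! ### Inserting a point into a cycle of a permutation -/

section Cycles

open Equiv Equiv.Perm

variable {ι R : Type*} [Fintype ι] [LinearOrder ι] [Ring R]

theorem sameCycle_iff_exists_nat_pow {σ : Perm ι} {x y : ι} :
    σ.SameCycle x y ↔ ∃ t : ℕ, (σ ^ t) x = y :=
  ⟨fun h => let ⟨t, _, ht⟩ := h.exists_pow_eq'; ⟨t, ht⟩, fun ⟨t, ht⟩ => ⟨t, by simpa using ht⟩⟩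

theorem pow_mul_swap_apply_of_not_sameCycle {τ : Perm ι} {i j x : ι} (hi : τ i = i)
    (hxi : x ≠ i) (hx : ¬ τ.SameCycle j x) (t : ℕ) : ((τ * swap i j) ^ t) x = (τ ^ t) x := by
  induction t with
  | zero => rfl
  | succ t ih =>
    have h1 : (τ ^ t) x ≠ i := by
      intro h
      have h2 : (τ ^ t) i = i := by
        rw [← iterate_eq_pow]; exact Function.iterate_fixed hi t
      exact hxi ((τ ^ t).injective (h.trans h2.symm))
    have h2 : (τ ^ t) x ≠ j := fun h => hx (sameCycle_iff_exists_nat_pow.mpr ⟨t, h⟩).symm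
    rw [pow_succ', Perm.mul_apply, ih, Perm.mul_apply, swap_apply_of_ne_of_ne h1 h2, pow_succ',
      Perm.mul_apply]

/-- As τ fixes i, the product `τ * swap i j` inserts i directly after j: its orbit is j, i, τ j, τ²
j, and so on. Hence the delay by one step. -/
theorem pow_mul_swap_apply_self {τ : Perm ι} {i j : ι} (hi : τ i = i) (hij : i ≠ j) {t : ℕ}
    (ht : t < Function.minimalPeriod τ j) :
    ((τ * swap i j) ^ (t + 2)) j = (τ ^ (t + 1)) j := by
  induction t with
  | zero => simp [pow_succ, hi]
  | succ t ih =>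
    have h1 : (τ ^ (t + 1)) j ≠ i := by
      intro h
      have h2 : (τ ^ (t + 1)) i = i := by
        rw [← iterate_eq_pow]; exact Function.iterate_fixed hi _
      exact hij ((τ ^ (t + 1)).injective (h.trans h2.symm)).symm
    have h2 : (τ ^ (t + 1)) j ≠ j := by
      intro h
      rw [← iterate_eq_pow] at h
      exact Function.not_isPeriodicPt_of_pos_of_lt_minimalPeriod (by omega) ht h
    rw [pow_succ', Perm.mul_apply, ih (by omega), Perm.mul_apply,
      swap_apply_of_ne_of_ne h1 h2, pow_succ' _ (t + 1), Perm.mul_apply]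

theorem minimalPeriod_pos (σ : Perm ι) (x : ι) : 0 < Function.minimalPeriod σ x :=
  Function.minimalPeriod_pos_of_mem_periodicPts
    (Function.Injective.mem_periodicPts σ.injective x)

theorem minimalPeriod_mul_swap {τ : Perm ι} {i j : ι} (hi : τ i = i) (hij : i ≠ j) :
    Function.minimalPeriod (τ * swap i j : Perm ι) j = Function.minimalPeriod τ j + 1 := by
  have hp := minimalPeriod_pos τ j
  apply le_antisymm
  · apply Function.IsPeriodicPt.minimalPeriod_le (by omega)
    have := pow_mul_swap_apply_self hi hij (t := Function.minimalPeriod τ j - 1) (by omega)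
    rw [show Function.minimalPeriod τ j - 1 + 2 = Function.minimalPeriod τ j + 1 by omega,
      show Function.minimalPeriod τ j - 1 + 1 = Function.minimalPeriod τ j by omega] at this
    show (τ * swap i j : Perm ι)^[_] j = j
    rw [iterate_eq_pow, this, ← iterate_eq_pow]
    exact Function.iterate_minimalPeriod
  · by_contra! h
    have h0 := minimalPeriod_pos (τ * swap i j) j
    have h1 : ((τ * swap i j) ^ Function.minimalPeriod (τ * swap i j : Perm ι) j) j = j := by
      rw [← iterate_eq_pow]; exact Function.iterate_minimalPeriod
    generalize Function.minimalPeriod (τ * swap i j : Perm ι) j = q at *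
    obtain rfl | ⟨t, rfl⟩ : q = 1 ∨ ∃ t, q = t + 2 := by
      rcases q with _ | _ | t
      · omega
      · simp
      · exact Or.inr ⟨t, rfl⟩
    · simp [hi] at h1; exact hij h1
    · rw [pow_mul_swap_apply_self hi hij (by omega), ← iterate_eq_pow] at h1
      exact Function.not_isPeriodicPt_of_pos_of_lt_minimalPeriod (by omega) (by omega) h1

theorem minimalPeriod_congr_pow {κ : Type*} {σ : Perm ι} {τ : Perm κ} {x : ι} {y : κ}
    (h : ∀ t : ℕ, (σ ^ t) x = x ↔ (τ ^ t) y = y) :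
    Function.minimalPeriod σ x = Function.minimalPeriod τ y := by
  rw [Function.minimalPeriod_eq_minimalPeriod_iff]
  intro t
  unfold Function.IsPeriodicPt Function.IsFixedPt
  rw [iterate_eq_pow, iterate_eq_pow, h]

theorem sameCycle_self_mul_swap {τ : Perm ι} {i j x : ι} (hi : τ i = i) (hij : i ≠ j)
    (hxi : x ≠ i) : (τ * swap i j).SameCycle j x ↔ τ.SameCycle j x := by
  constructor
  · intro h
    by_contra hx
    obtain ⟨t, ht⟩ := sameCycle_iff_exists_nat_pow.mp h.symm
    rw [pow_mul_swap_apply_of_not_sameCycle hi hxi hx] at ht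
    exact hx (sameCycle_iff_exists_nat_pow.mpr ⟨t, ht⟩).symm
  · intro h
    obtain ⟨t, ht⟩ := sameCycle_iff_exists_nat_pow.mp h
    rw [← iterate_eq_pow, ← Function.iterate_mod_minimalPeriod_eq, iterate_eq_pow] at ht
    have hlt := Nat.mod_lt t (minimalPeriod_pos τ j)
    generalize t % Function.minimalPeriod τ j = s at *
    rcases s with _ | s
    · simp at ht; rw [ht]
    · exact sameCycle_iff_exists_nat_pow.mpr
        ⟨s + 2, (pow_mul_swap_apply_self hi hij (by omega)).trans ht⟩

theorem sameCycle_mul_swap_of_not {τ : Perm ι} {i j x y : ι} (hi : τ i = i)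
    (hxi : x ≠ i) (hx : ¬ τ.SameCycle j x) :
    (τ * swap i j).SameCycle x y ↔ τ.SameCycle x y := by
  simp only [sameCycle_iff_exists_nat_pow, pow_mul_swap_apply_of_not_sameCycle hi hxi hx]

theorem rowCycle_mul_swap_of_not (A : Matrix ι ι R) {τ : Perm ι} {i j x : ι} (hi : τ i = i)
    (hxi : x ≠ i) (hx : ¬ τ.SameCycle j x) (b : ι → R) :
    rowCycle A (τ * swap i j) x = rowCycle (A.updateRow j b) τ x := by
  have hp : Function.minimalPeriod (τ * swap i j : Perm ι) x = Function.minimalPeriod τ x :=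
    minimalPeriod_congr_pow fun t => by rw [pow_mul_swap_apply_of_not_sameCycle hi hxi hx]
  unfold rowCycle
  rw [hp]
  congr 1
  apply List.map_congr_left
  intro t _
  rw [pow_mul_swap_apply_of_not_sameCycle hi hxi hx, pow_mul_swap_apply_of_not_sameCycle hi hxi hx,
    Matrix.updateRow_ne]
  exact fun h => hx (sameCycle_iff_exists_nat_pow.mpr ⟨t, h⟩).symm

/-- The step from j to i gives the factor `A j i`. The next step goes from i to τ j, so for τ the
row j has to carry the entries of row i. -/
theorem rowCycle_mul_swap_self (A : Matrix ι ι R) {τ : Perm ι} {i j : ι} (hi : τ i = i)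
    (hij : i ≠ j) : rowCycle A (τ * swap i j) j =
      A j i * rowCycle (A.updateRow j (A i)) τ j := by
  unfold rowCycle
  rw [minimalPeriod_mul_swap hi hij, List.range_succ_eq_map, List.map_cons, List.prod_cons,
    List.map_map]
  congr 1
  · simp [hi]
  · congr 1
    apply List.map_congr_left
    intro t ht
    rw [List.mem_range] at ht
    rcases t with _ | t
    · have h2 := pow_mul_swap_apply_self hi hij ht
      simp only [Function.comp, Nat.succ_eq_add_one, zero_add]
      rw [h2]
      simp [hi]
    · simp only [Function.comp, Nat.succ_eq_add_one]
      rw [pow_mul_swap_apply_self hi hij (by omega), pow_mul_swap_apply_self hi hij (by omega),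
        Matrix.updateRow_ne]
      intro h
      rw [← iterate_eq_pow] at h
      exact Function.not_isPeriodicPt_of_pos_of_lt_minimalPeriod (by omega) ht h

theorem rowCycle_updateRow_of_not (A : Matrix ι ι R) {τ : Perm ι} {j x : ι}
    (hx : ¬ τ.SameCycle j x) (b : ι → R) :
    rowCycle (A.updateRow j b) τ x = rowCycle A τ x := by
  unfold rowCycle
  congr 1
  apply List.map_congr_left
  intro t _
  rw [Matrix.updateRow_ne]
  exact fun h => hx (sameCycle_iff_exists_nat_pow.mpr ⟨t, h⟩).symm

theorem rowCycle_of_fixed (A : Matrix ι ι R) {σ : Perm ι} {j : ι} (hj : σ j = j) :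
    rowCycle A σ j = A j j := by
  have : Function.minimalPeriod σ j = 1 := Function.minimalPeriod_eq_one_iff_isFixedPt.mpr hj
  simp [rowCycle, this, hj]

end Cycles

/-! ### Expansion of the row determinant along its row -/

section Recursion

open Equiv Equiv.Perm

variable {ι R : Type*} [Fintype ι] [LinearOrder ι] [Ring R]

/-- The permutations that move only elements of `α`. -/
def permsOn (α : Finset ι) : Finset (Perm ι) :=
  Finset.univ.filter fun σ => ∀ x, x ∉ α → σ x = x

/-- The minimal elements of the cycles of `σ` in `α`, in increasing order. -/
def cycleMins (α : Finset ι) (σ : Perm ι) : List ι :=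
  (Finset.univ.filter fun x : ι => x ∈ α ∧ ∀ y : ι, σ.SameCycle x y → x ≤ y).sort

/-- The cycle leaders of `σ` in `α`, those of the cycle of `i` excepted. -/
def otherLeaders (α : Finset ι) (σ : Perm ι) (i : ι) : List ι :=
  (Finset.univ.filter fun x : ι =>
    x ∈ α ∧ ¬ σ.SameCycle i x ∧ ∀ y : ι, σ.SameCycle x y → x ≤ y).sort

/-- The row determinant along `i` of the principal submatrix on `α`, as a sum over permutations of
the whole index set. -/
noncomputable def rdetOn (A : Matrix ι ι R) (α : Finset ι) (i : ι) : R :=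
  ∑ σ ∈ permsOn α, (-1) ^ (α.card - ((otherLeaders α σ i).length + 1)) *
    (rowCycle A σ i * ((otherLeaders α σ i).map (rowCycle A σ)).prod)

/-- The determinant of the principal submatrix on `α`, as a sum over permutations of the whole
index set. -/
noncomputable def hdetOn (A : Matrix ι ι R) (α : Finset ι) : R :=
  ∑ σ ∈ permsOn α, (-1) ^ (α.card - (cycleMins α σ).length) *
    ((cycleMins α σ).map (rowCycle A σ)).prod

theorem mem_permsOn {α : Finset ι} {σ : Perm ι} : σ ∈ permsOn α ↔ ∀ x, x ∉ α → σ x = x := by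
  simp [permsOn]

theorem sameCycle_iff_eq_of_fixed {σ : Perm ι} {j x : ι} (hj : σ j = j) :
    σ.SameCycle j x ↔ x = j := by
  constructor
  · rintro h
    exact (h.eq_of_left hj).symm
  · rintro rfl; rfl

theorem otherLeaders_eq_cycleMins {α : Finset ι} {σ : Perm ι} {j : ι} (hj : σ j = j) :
    otherLeaders α σ j = cycleMins (α.erase j) σ := by
  unfold otherLeaders cycleMins
  congr 1
  ext x
  simp only [Finset.mem_filter, Finset.mem_univ, true_and, Finset.mem_erase,
    sameCycle_iff_eq_of_fixed hj]
  tauto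

theorem otherLeaders_mul_swap {α : Finset ι} {τ : Perm ι} {i j : ι} (hi : τ i = i)
    (hij : i ≠ j) : otherLeaders α (τ * swap i j) j = otherLeaders (α.erase i) τ j := by
  unfold otherLeaders
  congr 1
  ext x
  simp only [Finset.mem_filter, Finset.mem_univ, true_and, Finset.mem_erase]
  by_cases hxi : x = i
  · subst hxi
    have : (τ * swap x j).SameCycle j x := sameCycle_iff_exists_nat_pow.mpr ⟨1, by simp [hi]⟩
    simp [this]
  · rw [sameCycle_self_mul_swap hi hij hxi]
    by_cases hx : τ.SameCycle j x
    · simp [hx]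
    · simp only [sameCycle_mul_swap_of_not hi hxi hx]
      tauto

theorem mem_otherLeaders {α : Finset ι} {σ : Perm ι} {j x : ι} :
    x ∈ otherLeaders α σ j ↔ x ∈ α ∧ ¬ σ.SameCycle j x ∧ ∀ y : ι, σ.SameCycle x y → x ≤ y := by
  simp [otherLeaders]

theorem length_otherLeaders_lt {α : Finset ι} {σ : Perm ι} {j : ι} (hj : j ∈ α) :
    (otherLeaders α σ j).length + 1 ≤ α.card := by
  unfold otherLeaders
  rw [Finset.length_sort]
  have : (Finset.univ.filter fun x : ι =>
      x ∈ α ∧ ¬ σ.SameCycle j x ∧ ∀ y : ι, σ.SameCycle x y → x ≤ y) ⊆ α.erase j := by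
    intro x
    simp only [Finset.mem_filter, Finset.mem_univ, true_and, Finset.mem_erase]
    rintro ⟨h1, h2, _⟩
    refine ⟨?_, h1⟩
    rintro rfl
    exact h2 (SameCycle.refl _ _)
  have := Finset.card_le_card this
  rw [Finset.card_erase_of_mem hj] at this
  have := Finset.card_pos.mpr ⟨j, hj⟩
  omega

/-- Permutations are sorted by i = σ j. If i ≠ j, removing i from the cycle of j leaves the number
of cycles unchanged and lowers the size by one, whence the minus sign. The factor `A j i` is the
leftmost one, so no commutativity is needed. -/
theorem rdetOn_eq (A : Matrix ι ι R) (α : Finset ι) {j : ι} (hj : j ∈ α) :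
    rdetOn A α j = A j j * hdetOn A (α.erase j) +
      ∑ i ∈ α.erase j, A j i * -rdetOn (A.updateRow j (A i)) (α.erase i) j := by
  have hfib : ∀ σ ∈ permsOn α, σ j ∈ α := by
    intro σ hσ
    by_contra h
    have h1 := mem_permsOn.mp hσ _ h
    exact h ((σ.injective h1).symm ▸ hj)
  have hpos := Finset.card_pos.mpr ⟨j, hj⟩
  unfold rdetOn
  rw [← Finset.sum_fiberwise_of_maps_to hfib, ← Finset.add_sum_erase _ _ hj]
  congr 1
  · unfold hdetOn
    rw [Finset.mul_sum]
    refine Finset.sum_congr ?_ ?_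
    · ext σ
      simp only [Finset.mem_filter, mem_permsOn, Finset.mem_erase]
      constructor
      · rintro ⟨h1, h2⟩ x hx
        by_cases hxj : x = j
        · rw [hxj, h2]
        · exact h1 x fun h => hx ⟨hxj, h⟩
      · intro h
        exact ⟨fun x hx => h x fun h' => hx h'.2, h j fun h' => h'.1 rfl⟩
    · intro σ hσ
      have hσj : σ j = j := mem_permsOn.mp hσ j (Finset.notMem_erase j α)
      rw [otherLeaders_eq_cycleMins hσj, rowCycle_of_fixed A hσj, Finset.card_erase_of_mem hj,
        show α.card - ((cycleMins (α.erase j) σ).length + 1) =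
          α.card - 1 - (cycleMins (α.erase j) σ).length by omega, ← mul_assoc, ← mul_assoc,
        ((Commute.neg_one_left (A j j)).pow_left _).eq]
  · refine Finset.sum_congr rfl fun i hi => ?_
    obtain ⟨hij, hiα⟩ := Finset.mem_erase.mp hi
    rw [mul_neg, Finset.mul_sum, ← Finset.sum_neg_distrib]
    have hji : j ∈ α.erase i := Finset.mem_erase.mpr ⟨hij.symm, hj⟩
    refine Finset.sum_bij' (fun σ _ => σ * swap i j) (fun τ _ => τ * swap i j) ?_ ?_ ?_ ?_ ?_
    · intro σ hσ
      simp only [Finset.mem_filter, mem_permsOn] at hσ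
      rw [mem_permsOn]
      intro x hx
      by_cases hxi : x = i
      · subst hxi; simp [hσ.2]
      · have hxα : x ∉ α := fun h => hx (Finset.mem_erase.mpr ⟨hxi, h⟩)
        rw [Perm.mul_apply, swap_apply_of_ne_of_ne hxi (fun h => hxα (h ▸ hj)), hσ.1 x hxα]
    · intro τ hτ
      rw [mem_permsOn] at hτ
      simp only [Finset.mem_filter, mem_permsOn]
      refine ⟨fun x hx => ?_, by simp [hτ i (Finset.notMem_erase i α)]⟩
      rw [Perm.mul_apply, swap_apply_of_ne_of_ne (ne_of_mem_of_not_mem hiα hx).symm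
        (ne_of_mem_of_not_mem hj hx).symm,
        hτ x fun h => hx (Finset.mem_of_mem_erase h)]
    · intro σ _; simp [mul_assoc]
    · intro σ _; simp [mul_assoc]
    · intro σ hσ
      simp only [Finset.mem_filter, mem_permsOn] at hσ
      obtain ⟨τ, rfl⟩ : ∃ τ, σ = τ * swap i j := ⟨σ * swap i j, by simp [mul_assoc]⟩
      have hτi : τ i = i := by simpa using hσ.2
      rw [mul_assoc τ, swap_mul_self, mul_one, otherLeaders_mul_swap hτi hij,
        rowCycle_mul_swap_self A hτi hij, Finset.card_erase_of_mem hiα]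
      -- This bound makes the truncated subtraction in the exponent of the sign exact.
      have hlen := length_otherLeaders_lt (σ := τ) hji
      rw [Finset.card_erase_of_mem hiα] at hlen
      have hmap : (otherLeaders (α.erase i) τ j).map (rowCycle A (τ * swap i j)) =
          (otherLeaders (α.erase i) τ j).map (rowCycle (A.updateRow j (A i)) τ) := by
        apply List.map_congr_left
        intro x hx
        rw [mem_otherLeaders] at hx
        exact rowCycle_mul_swap_of_not A hτi (Finset.mem_erase.mp hx.1).1 hx.2.1 _
      rw [hmap, show α.card - ((otherLeaders (α.erase i) τ j).length + 1) =
        α.card - 1 - ((otherLeaders (α.erase i) τ j).length + 1) + 1 by omega, pow_succ,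
        mul_neg_one, neg_mul, neg_inj, mul_assoc (A j i), ← mul_assoc, ← mul_assoc (A j i),
        ((Commute.neg_one_left (A j i)).pow_left _).eq]

theorem hdetOn_updateRow (A : Matrix ι ι R) (α : Finset ι) {j : ι} (hj : j ∉ α) (b : ι → R) :
    hdetOn (A.updateRow j b) α = hdetOn A α := by
  unfold hdetOn
  refine Finset.sum_congr rfl fun σ hσ => ?_
  congr 2
  apply List.map_congr_left
  intro x hx
  apply rowCycle_updateRow_of_not
  have hxα : x ∈ α := by simp [cycleMins] at hx; exact hx.1
  rw [sameCycle_iff_eq_of_fixed (mem_permsOn.mp hσ j hj)]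
  rintro rfl
  exact hj hxα

theorem hdetOn_empty (A : Matrix ι ι R) : hdetOn A ∅ = 1 := by
  have : permsOn (∅ : Finset ι) = {1} := by
    ext σ
    simp [mem_permsOn, Equiv.ext_iff]
  simp [hdetOn, this, cycleMins]

/-- The least element of α is the least element of its own cycle and precedes all other leaders, so
the two orders of the cycles agree. -/
theorem hdetOn_eq_rdetOn (A : Matrix ι ι R) {α : Finset ι} (h : α.Nonempty) :
    hdetOn A α = rdetOn A α (α.min' h) := by
  unfold hdetOn rdetOn
  refine Finset.sum_congr rfl fun σ hσ => ?_
  rw [mem_permsOn] at hσ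
  have hmem : ∀ {x y}, x ∈ α → σ.SameCycle x y → y ∈ α := by
    intro x y hx hxy
    by_contra hy
    have := (sameCycle_iff_eq_of_fixed (hσ y hy)).mp hxy.symm
    exact hy (this ▸ hx)
  have key : cycleMins α σ = α.min' h :: otherLeaders α σ (α.min' h) := by
    unfold cycleMins otherLeaders
    have hnot : α.min' h ∉ Finset.univ.filter fun x : ι =>
        x ∈ α ∧ ¬ σ.SameCycle (α.min' h) x ∧ ∀ y : ι, σ.SameCycle x y → x ≤ y := by
      simp only [Finset.mem_filter, Finset.mem_univ, true_and]
      exact fun hx => hx.2.1 (SameCycle.refl _ _)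
    rw [← Finset.sort_cons (r := (· ≤ ·)) (h₂ := hnot)]
    · congr 1
      ext x
      simp only [Finset.mem_filter, Finset.mem_univ, true_and, Finset.mem_cons]
      constructor
      · rintro ⟨h1, h2⟩
        by_cases hs : σ.SameCycle (α.min' h) x
        · exact Or.inl (le_antisymm (h2 _ hs.symm) (α.min'_le x h1))
        · exact Or.inr ⟨h1, hs, h2⟩
      · rintro (rfl | ⟨h1, _, h2⟩)
        · exact ⟨α.min'_mem h, fun y hy => α.min'_le y (hmem (α.min'_mem h) hy)⟩
        · exact ⟨h1, h2⟩
    · intro x hx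
      simp only [Finset.mem_filter, Finset.mem_univ, true_and] at hx
      exact α.min'_le x hx.1
  rw [key, List.length_cons, List.map_cons, List.prod_cons]

end Recursion

/-! ### Principal submatrices as index sets in a fixed type -/

section Subtype

open Equiv Equiv.Perm

variable {ι R : Type*} [Fintype ι] [LinearOrder ι] [Ring R]

theorem ofSubtype_pow_apply {α : Finset ι} (σ : Perm α) (x : α) (t : ℕ) :
    ((ofSubtype σ) ^ t) (x : ι) = ((σ ^ t) x : α) := by
  rw [← map_pow, ofSubtype_apply_coe]

theorem rowCycle_ofSubtype (A : Matrix ι ι R) {α : Finset ι} (σ : Perm α) (x : α) :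
    rowCycle A (ofSubtype σ) (x : ι) = rowCycle (A.submatrix Subtype.val Subtype.val) σ x := by
  have hp : Function.minimalPeriod (ofSubtype σ : Perm ι) (x : ι) = Function.minimalPeriod σ x :=
    minimalPeriod_congr_pow fun t => by rw [ofSubtype_pow_apply, Subtype.coe_inj]
  unfold rowCycle
  rw [hp]
  simp only [ofSubtype_pow_apply, Matrix.submatrix_apply]

theorem sameCycle_ofSubtype {α : Finset ι} (σ : Perm α) (x y : α) :
    (ofSubtype σ : Perm ι).SameCycle x y ↔ σ.SameCycle x y := by
  simp only [sameCycle_iff_exists_nat_pow, ofSubtype_pow_apply, Subtype.coe_inj]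

theorem ofSubtype_mem_permsOn {α : Finset ι} (σ : Perm α) : ofSubtype σ ∈ permsOn α :=
  mem_permsOn.mpr fun _ hx => ofSubtype_apply_of_not_mem σ hx

theorem leaders_ofSubtype {α : Finset ι} (σ : Perm α) (i : α) :
    (leaders σ i).map Subtype.val = (i : ι) :: otherLeaders α (ofSubtype σ) i := by
  have hmem : ∀ {x y : ι}, x ∈ α → (ofSubtype σ : Perm ι).SameCycle x y → y ∈ α := by
    intro x y hx hxy
    by_contra hy
    have := (sameCycle_iff_eq_of_fixed (mem_permsOn.mp (ofSubtype_mem_permsOn σ) y hy)).mp hxy.symm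
    exact hy (this ▸ hx)
  unfold leaders otherLeaders
  rw [List.map_cons]
  congr 1
  apply List.Perm.eq_of_pairwise' (r := (· ≤ ·))
  · rw [List.pairwise_map]
    exact Finset.pairwise_sort _ _
  · exact Finset.pairwise_sort _ _
  · apply (List.perm_ext_iff_of_nodup _ _).mpr
    · intro x
      simp only [List.mem_map, Finset.mem_sort, Finset.mem_filter, Finset.mem_univ, true_and]
      constructor
      · rintro ⟨⟨x, hx⟩, ⟨h1, h2⟩, rfl⟩
        refine ⟨hx, fun h => h1 ((sameCycle_ofSubtype σ i ⟨x, hx⟩).mp h), fun y hy => ?_⟩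
        exact h2 ⟨y, hmem hx hy⟩ ((sameCycle_ofSubtype σ ⟨x, hx⟩ ⟨y, hmem hx hy⟩).mp hy)
      · rintro ⟨hx, h1, h2⟩
        refine ⟨⟨x, hx⟩, ⟨fun h => h1 ((sameCycle_ofSubtype σ i ⟨x, hx⟩).mpr h), fun y hy => ?_⟩,
          rfl⟩
        exact h2 y ((sameCycle_ofSubtype σ ⟨x, hx⟩ y).mpr hy)
    · exact (Finset.sort_nodup _ _).map Subtype.val_injective
    · exact Finset.sort_nodup _ _

/-- Extension by the identity preserves cycles and their order. Inductions over α can then erase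
indices without changing the index type. -/
theorem rdet_submatrix (A : Matrix ι ι R) {α : Finset ι} (i : α) :
    rdet (A.submatrix Subtype.val Subtype.val : Matrix α α R) i = rdetOn A α i := by
  unfold rdet rdetOn
  refine Finset.sum_bij (fun σ _ => ofSubtype σ) (fun σ _ => ofSubtype_mem_permsOn σ)
    (fun σ _ τ _ h => ofSubtype_injective h) ?_ ?_
  · intro τ hτ
    rw [mem_permsOn] at hτ
    have h2 : ∀ x, τ x ∈ α ↔ x ∈ α := by
      intro x
      constructor
      · intro h
        by_contra hx
        rw [hτ x hx] at h
        exact hx h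
      · intro h
        by_contra hx
        exact hx ((τ.injective (hτ _ hx)).symm ▸ h)
    refine ⟨τ.subtypePerm h2, Finset.mem_univ _, ofSubtype_subtypePerm _ fun x hx => ?_⟩
    by_contra h
    exact hx (hτ x h)
  · intro σ _
    have h := leaders_ofSubtype σ i
    have hlen : (leaders σ i).length = (otherLeaders α (ofSubtype σ) i).length + 1 := by
      simpa using congrArg List.length h
    have hprod : (leaders σ i).map (rowCycle (A.submatrix Subtype.val Subtype.val) σ) =
        ((i : ι) :: otherLeaders α (ofSubtype σ) i).map (rowCycle A (ofSubtype σ)) := by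
      rw [← h, List.map_map]
      exact List.map_congr_left fun x _ => (rowCycle_ofSubtype A σ x).symm
    rw [hlen, hprod, Fintype.card_coe, List.map_cons, List.prod_cons]

theorem hdet_submatrix (A : Matrix ι ι R) (α : Finset ι) :
    hdet (A.submatrix Subtype.val Subtype.val : Matrix α α R) = hdetOn A α := by
  unfold hdet
  split_ifs with h
  · have hne : α.Nonempty := Finset.nonempty_coe_sort.mp h
    rw [rdet_submatrix, hdetOn_eq_rdetOn A hne]
    congr 1
    apply le_antisymm
    · exact Finset.min'_le _ (⟨_, α.min'_mem hne⟩ : α) (Finset.mem_univ _)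
    · exact α.min'_le _ (Subtype.prop _)
  · have : α = ∅ := by
      rw [← Finset.not_nonempty_iff_eq_empty]
      exact fun h' => h (Finset.nonempty_coe_sort.mpr h')
    subst this
    rw [hdetOn_empty]

end Subtype

/-! ### Column determinants as adjoints of row determinants -/

section Adjoint

variable {ι R : Type*} [Fintype ι] [LinearOrder ι] [Ring R] [StarRing R]

theorem star_list_prod (l : List R) : star l.prod = (l.reverse.map star).prod := by
  induction l with
  | nil => simp
  | cons a l ih => simp [ih]

theorem star_rowCycle_conjTranspose (A : Matrix ι ι R) (σ : Equiv.Perm ι) (x : ι) :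
    star (rowCycle Aᴴ σ x) = colCycle A σ x := by
  unfold rowCycle colCycle
  rw [star_list_prod, ← List.map_reverse, List.map_map]
  congr 1
  apply List.map_congr_left
  intro t _
  simp

theorem cdet_eq_star_rdet (A : Matrix ι ι R) (j : ι) : cdet A j = star (rdet Aᴴ j) := by
  unfold cdet rdet
  rw [star_sum]
  refine Finset.sum_congr rfl fun σ _ => ?_
  rw [star_mul, star_list_prod, ← List.map_reverse, List.map_map]
  have h : star ((-1 : R) ^ (Fintype.card ι - (leaders σ j).length)) =
      (-1) ^ (Fintype.card ι - (leaders σ j).length) := by simp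
  rw [h, ((Commute.neg_one_left _).pow_left _).eq]
  congr 2
  apply List.map_congr_left
  intro x _
  exact (star_rowCycle_conjTranspose A σ x).symm

end Adjoint

/-! ### Cofactors of the row determinant -/

section Cofactors

variable {ι R : Type*} [Fintype ι] [LinearOrder ι] [Ring R]

/-- The cofactors of the row determinant along `j` on the index set `α`: the coefficient of `b l` in
the determinant in which the row `j` is replaced by `b`. -/
noncomputable def cof (H : Matrix ι ι R) (α : Finset ι) (l j : ι) : R :=
  if l = j then hdetOn H (α.erase j) else -rdetOn (H.updateRow j (H l)) (α.erase l) j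

theorem cof_self (H : Matrix ι ι R) (α : Finset ι) (j : ι) :
    cof H α j j = hdetOn H (α.erase j) := if_pos rfl

theorem cof_of_ne (H : Matrix ι ι R) (α : Finset ι) {l j : ι} (h : l ≠ j) :
    cof H α l j = -rdetOn (H.updateRow j (H l)) (α.erase l) j := if_neg h

theorem rdetOn_updateRow (H : Matrix ι ι R) {α : Finset ι} {j : ι} (hj : j ∈ α) (b : ι → R) :
    rdetOn (H.updateRow j b) α j = ∑ l ∈ α, b l * cof H α l j := by
  rw [rdetOn_eq _ α hj, ← Finset.add_sum_erase α _ hj, hdetOn_updateRow _ _ (Finset.notMem_erase j α),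
    cof_self, Matrix.updateRow_self]
  congr 1
  refine Finset.sum_congr rfl fun i hi => ?_
  have hij := (Finset.mem_erase.mp hi).1
  rw [cof_of_ne _ _ hij, Matrix.updateRow_ne hij, Matrix.updateRow_idem]

theorem rdetOn_eq_sum_cof (H : Matrix ι ι R) {α : Finset ι} {j : ι} (hj : j ∈ α) :
    rdetOn H α j = ∑ l ∈ α, H j l * cof H α l j := by
  rw [← rdetOn_updateRow H hj, Matrix.updateRow_eq_self]

theorem cof_of_ne_eq_sum (H : Matrix ι ι R) {α : Finset ι} {l j : ι} (hj : j ∈ α) (h : l ≠ j) :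
    cof H α l j = -∑ t ∈ α.erase l, H l t * cof H (α.erase l) t j := by
  rw [cof_of_ne H α h, rdetOn_updateRow H (Finset.mem_erase.mpr ⟨h.symm, hj⟩)]

theorem continuous_rdetOn [TopologicalSpace R] [IsTopologicalRing R] (α : Finset ι) (j : ι) :
    Continuous fun A : Matrix ι ι R => rdetOn A α j := by
  have hrow : ∀ (σ : Equiv.Perm ι) (x : ι), Continuous fun A : Matrix ι ι R => rowCycle A σ x := by
    intro σ x
    unfold rowCycle
    exact continuous_list_prod _ fun t _ => continuous_id.matrix_elem _ _
  unfold rdetOn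
  refine continuous_finsetSum _ fun σ _ => continuous_const.mul ((hrow σ j).mul ?_)
  exact continuous_list_prod _ fun x _ => hrow σ x

end Cofactors

/-! ### Cofactor laws for Hermitian quaternion matrices -/

section Hermitian

open scoped Quaternion

variable {ι : Type*} [Fintype ι] [LinearOrder ι]

theorem commute_of_star_eq {a : ℍ[ℝ]} (h : star a = a) (b : ℍ[ℝ]) : a * b = b * a := by
  rw [Quaternion.star_eq_self.mp h]
  exact Quaternion.coe_commutes _ _

/-- The cofactor matrix on `α` is Hermitian, the determinant is real, and `H` times the cofactor
matrix is the determinant. -/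
structure CofactorLaws (H : Matrix ι ι ℍ[ℝ]) (α : Finset ι) : Prop where
  star_hdetOn : star (hdetOn H α) = hdetOn H α
  star_cof : ∀ l ∈ α, ∀ j ∈ α, star (cof H α l j) = cof H α j l
  sum_mul_cof : ∀ i ∈ α, ∀ j ∈ α, ∑ l ∈ α, H i l * cof H α l j = if i = j then hdetOn H α else 0

/-- The adjoint of the row expansion `cof_of_ne_eq_sum`: an expansion along the column j. -/
theorem cof_eq_neg_sum_mul {H : Matrix ι ι ℍ[ℝ]} (hH : H.IsHermitian) {α : Finset ι} {l j : ι}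
    (hl : l ∈ α) (hne : l ≠ j) (hα : ∀ l ∈ α, ∀ j ∈ α, star (cof H α l j) = cof H α j l)
    (hj : j ∈ α) (ih : CofactorLaws H (α.erase j)) :
    cof H α l j = -∑ t ∈ α.erase j, cof H (α.erase j) l t * H t j := by
  rw [← hα j hj l hl, cof_of_ne_eq_sum H hl hne.symm, star_neg, star_sum]
  congr 1
  refine Finset.sum_congr rfl fun t ht => ?_
  rw [star_mul, ih.star_cof t ht l (Finset.mem_erase.mpr ⟨hne, hl⟩), hH.apply t j]

/-- Expanding along the row l and then along the column j expresses an off-diagonal cofactor by the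
laws' data on α without l and j. The adjoint carries this expression to the one with l and j
exchanged. -/
theorem star_cof_of_erase {H : Matrix ι ι ℍ[ℝ]} (hH : H.IsHermitian) {α : Finset ι}
    (ih : ∀ β, β ⊂ α → CofactorLaws H β) :
    ∀ l ∈ α, ∀ j ∈ α, star (cof H α l j) = cof H α j l := by
  have key : ∀ l ∈ α, ∀ j ∈ α, l ≠ j → cof H α l j = -(H l j * hdetOn H ((α.erase l).erase j) -
      ∑ t ∈ (α.erase l).erase j, ∑ u ∈ (α.erase l).erase j,
        H l t * cof H ((α.erase l).erase j) t u * H u j) := by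
    intro l hl j hj hne
    have hjl : j ∈ α.erase l := Finset.mem_erase.mpr ⟨hne.symm, hj⟩
    have ih1 := ih _ (Finset.erase_ssubset hl)
    have ih2 := ih ((α.erase l).erase j)
      ((Finset.erase_ssubset hjl).trans (Finset.erase_ssubset hl))
    rw [cof_of_ne_eq_sum H hj hne, ← Finset.add_sum_erase _ _ hjl, cof_self, sub_eq_add_neg,
      ← Finset.sum_neg_distrib]
    congr 2
    refine Finset.sum_congr rfl fun t ht => ?_
    obtain ⟨htj, htl⟩ := Finset.mem_erase.mp ht
    rw [cof_eq_neg_sum_mul hH htl htj ih1.star_cof hjl ih2, mul_neg, Finset.mul_sum]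
    simp only [mul_assoc]
  intro l hl j hj
  by_cases hne : l = j
  · subst hne
    rw [cof_self, (ih _ (Finset.erase_ssubset hl)).star_hdetOn]
  · have hjl : j ∈ α.erase l := Finset.mem_erase.mpr ⟨Ne.symm hne, hj⟩
    have ih2 := ih ((α.erase l).erase j)
      ((Finset.erase_ssubset hjl).trans (Finset.erase_ssubset hl))
    rw [key l hl j hj hne, key j hj l hl (Ne.symm hne), Finset.erase_right_comm (a := j)]
    rw [star_neg, star_sub, star_mul, ih2.star_hdetOn, hH.apply, commute_of_star_eq ih2.star_hdetOn,
      star_sum]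
    simp only [star_sum]
    rw [Finset.sum_comm]
    congr 2
    refine Finset.sum_congr rfl fun t ht => Finset.sum_congr rfl fun u hu => ?_
    rw [star_mul, star_mul, ih2.star_cof u hu t ht, hH.apply, hH.apply, mul_assoc]

/-- After column expansion the laws on `α.erase j` collapse the inner sum to its term t = i, which
cancels the term l = j because the smaller determinant is real. -/
theorem sum_mul_cof_of_ne {H : Matrix ι ι ℍ[ℝ]} (hH : H.IsHermitian) {α : Finset ι}
    (ih : ∀ β, β ⊂ α → CofactorLaws H β) {i j : ι} (hi : i ∈ α) (hj : j ∈ α) (hij : i ≠ j) :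
    ∑ l ∈ α, H i l * cof H α l j = 0 := by
  have ih1 := ih _ (Finset.erase_ssubset hj)
  have hij' : i ∈ α.erase j := Finset.mem_erase.mpr ⟨hij, hi⟩
  rw [← Finset.add_sum_erase _ _ hj, cof_self]
  have : ∀ l ∈ α.erase j, H i l * cof H α l j =
      -∑ t ∈ α.erase j, H i l * cof H (α.erase j) l t * H t j := by
    intro l hl
    obtain ⟨hlj, hlα⟩ := Finset.mem_erase.mp hl
    rw [cof_eq_neg_sum_mul hH hlα hlj (star_cof_of_erase hH ih) hj ih1, mul_neg, Finset.mul_sum]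
    simp only [mul_assoc]
  rw [Finset.sum_congr rfl this, Finset.sum_neg_distrib, Finset.sum_comm]
  have h2 : ∀ t ∈ α.erase j, ∑ l ∈ α.erase j, H i l * cof H (α.erase j) l t * H t j =
      if i = t then hdetOn H (α.erase j) * H t j else 0 := by
    intro t ht
    rw [← Finset.sum_mul, ih1.sum_mul_cof i hij' t ht, ite_mul, zero_mul]
  rw [Finset.sum_congr rfl h2, Finset.sum_ite_eq, if_pos hij', commute_of_star_eq ih1.star_hdetOn,
    add_neg_cancel]

theorem star_rdetOn {H : Matrix ι ι ℍ[ℝ]} (hH : H.IsHermitian) {α : Finset ι}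
    (ih : ∀ β, β ⊂ α → CofactorLaws H β) {j : ι} (hj : j ∈ α) :
    star (rdetOn H α j) = rdetOn H α j := by
  have ih1 := ih _ (Finset.erase_ssubset hj)
  have key : rdetOn H α j = H j j * hdetOn H (α.erase j) -
      ∑ l ∈ α.erase j, ∑ t ∈ α.erase j, H j l * cof H (α.erase j) l t * H t j := by
    rw [rdetOn_eq_sum_cof H hj, ← Finset.add_sum_erase _ _ hj, cof_self, sub_eq_add_neg,
      ← Finset.sum_neg_distrib]
    congr 1
    refine Finset.sum_congr rfl fun l hl => ?_
    obtain ⟨hlj, hlα⟩ := Finset.mem_erase.mp hl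
    rw [cof_eq_neg_sum_mul hH hlα hlj (star_cof_of_erase hH ih) hj ih1, mul_neg, Finset.mul_sum]
    simp only [mul_assoc]
  rw [key, star_sub, star_mul, ih1.star_hdetOn, hH.apply, commute_of_star_eq ih1.star_hdetOn,
    star_sum]
  simp only [star_sum]
  rw [Finset.sum_comm]
  congr 1
  refine Finset.sum_congr rfl fun t ht => Finset.sum_congr rfl fun u hu => ?_
  rw [star_mul, star_mul, ih1.star_cof u hu t ht, hH.apply, hH.apply, mul_assoc]

/-- With C the cofactor matrix on α, HC is diagonal with the row determinants as entries, and so is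
CH by taking adjoints. The (i, j) entry of (HC)H = H(CH) then compares the two determinants; they
are real, and H i j can be cancelled. -/
theorem rdetOn_eq_of_apply_ne_zero {H : Matrix ι ι ℍ[ℝ]} (hH : H.IsHermitian) {α : Finset ι}
    (ih : ∀ β, β ⊂ α → CofactorLaws H β) {i j : ι} (hi : i ∈ α) (hj : j ∈ α) (hij : H i j ≠ 0) :
    rdetOn H α i = rdetOn H α j := by
  have hl : ∀ i ∈ α, ∀ j ∈ α,
      ∑ l ∈ α, H i l * cof H α l j = if i = j then rdetOn H α j else 0 := by
    intro i hi j hj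
    split_ifs with h
    · rw [h, rdetOn_eq_sum_cof H hj]
    · exact sum_mul_cof_of_ne hH ih hi hj h
  have hr : ∀ i ∈ α, ∀ j ∈ α,
      ∑ l ∈ α, cof H α i l * H l j = if i = j then rdetOn H α i else 0 := by
    intro i hi j hj
    have h := congrArg star (hl j hj i hi)
    rw [star_sum] at h
    calc ∑ l ∈ α, cof H α i l * H l j = ∑ l ∈ α, star (H j l * cof H α l i) := by
          refine Finset.sum_congr rfl fun l hlα => ?_
          rw [star_mul, star_cof_of_erase hH ih l hlα i hi, hH.apply]
      _ = _ := by
          rw [h, apply_ite star, star_rdetOn hH ih hi, star_zero]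
          simp only [eq_comm]
  have h1 : ∑ l ∈ α, (∑ t ∈ α, H i t * cof H α t l) * H l j = rdetOn H α i * H i j := by
    rw [Finset.sum_congr rfl fun l hlα => by rw [hl i hi l hlα, ite_mul, zero_mul],
      Finset.sum_ite_eq, if_pos hi]
  have h2 : ∑ t ∈ α, H i t * (∑ l ∈ α, cof H α t l * H l j) = H i j * rdetOn H α j := by
    rw [Finset.sum_congr rfl fun t ht => by rw [hr t ht j hj, mul_ite, mul_zero],
      Finset.sum_ite_eq', if_pos hj]
  have h3 : rdetOn H α i * H i j = H i j * rdetOn H α j := by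
    rw [← h1, ← h2]
    simp only [Finset.sum_mul, Finset.mul_sum]
    rw [Finset.sum_comm]
    simp only [mul_assoc]
  rw [← commute_of_star_eq (star_rdetOn hH ih hj)] at h3
  exact mul_right_cancel₀ hij h3

theorem rdetOn_eq_of_isHermitian {H : Matrix ι ι ℍ[ℝ]} (hH : H.IsHermitian) {α : Finset ι}
    (ih : ∀ β, β ⊂ α → ∀ H : Matrix ι ι ℍ[ℝ], H.IsHermitian → CofactorLaws H β) {i j : ι}
    (hi : i ∈ α) (hj : j ∈ α) : rdetOn H α i = rdetOn H α j := by
  by_cases hij : i = j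
  · rw [hij]
  by_cases h0 : H i j = 0
  swap
  · exact rdetOn_eq_of_apply_ne_zero hH (fun β hβ => ih β hβ H hH) hi hj h0
  -- A Hermitian perturbation whose (i, j) entry is t. The determinants agree for t ≠ 0, hence at t
  -- = 0 by continuity; this is why the induction hypothesis ranges over all Hermitian matrices.
  let P : ℝ → Matrix ι ι ℍ[ℝ] := fun t =>
    H + t • (Matrix.single i j 1 + Matrix.single j i 1)
  have hP : Continuous P := by
    refine continuous_const.add (continuous_id.smul continuous_const)
  have hPH : ∀ t, (P t).IsHermitian := by
    intro t
    have h1 : (Matrix.single i j (1 : ℍ[ℝ]) + Matrix.single j i 1).IsHermitian := by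
      unfold Matrix.IsHermitian
      rw [Matrix.conjTranspose_add, Matrix.conjTranspose_single, Matrix.conjTranspose_single,
        star_one, add_comm]
    refine hH.add ?_
    ext1 a b
    rw [Matrix.conjTranspose_apply, Matrix.smul_apply, Matrix.smul_apply, Quaternion.star_smul,
      h1.apply]
  have hPij : ∀ t, t ≠ 0 → P t i j ≠ 0 := by
    intro t ht
    have : P t i j = (t : ℍ[ℝ]) := by
      rw [← Quaternion.algebraMap_def, Algebra.algebraMap_eq_smul_one]
      simp [P, h0, Matrix.single, Ne.symm hij]
    rw [this]
    exact fun h => ht (Quaternion.coe_injective (h.trans Quaternion.coe_zero.symm))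
  have hclosed : Set.EqOn (fun t => rdetOn (P t) α i) (fun t => rdetOn (P t) α j) {0}ᶜ := by
    intro t ht
    exact rdetOn_eq_of_apply_ne_zero (hPH t) (fun β hβ => ih β hβ _ (hPH t)) hi hj (hPij t ht)
  have := congrFun (Continuous.ext_on (dense_compl_singleton (0 : ℝ))
    ((continuous_rdetOn α i).comp hP) ((continuous_rdetOn α j).comp hP) hclosed) 0
  simpa [P] using this

theorem cofactorLaws {H : Matrix ι ι ℍ[ℝ]} (hH : H.IsHermitian) (α : Finset ι) :
    CofactorLaws H α := by
  induction α using Finset.strongInduction generalizing H with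
  | H α ih =>
    have ih' : ∀ β, β ⊂ α → CofactorLaws H β := fun β hβ => ih β hβ hH
    have hdet : ∀ j ∈ α, rdetOn H α j = hdetOn H α := by
      intro j hj
      have hne : α.Nonempty := ⟨j, hj⟩
      rw [hdetOn_eq_rdetOn H hne]
      exact rdetOn_eq_of_isHermitian hH (fun β hβ H hH => ih β hβ hH) hj (α.min'_mem hne)
    refine ⟨?_, star_cof_of_erase hH ih', ?_⟩
    · rcases α.eq_empty_or_nonempty with rfl | ⟨j, hj⟩
      · rw [hdetOn_empty, star_one]
      · rw [← hdet j hj, star_rdetOn hH ih' hj]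
    · intro i hi j hj
      split_ifs with h
      · rw [h, ← rdetOn_eq_sum_cof H hj, hdet j hj]
      · exact sum_mul_cof_of_ne hH ih' hi hj h

end Hermitian

/-! ### Sums of cofactor matrices and the Faddeev–LeVerrier recursion -/

section MinorSums

open scoped Quaternion

variable {m n : ℕ}

/-- The sum of the cofactor matrices of the principal submatrices of size `s`. -/
noncomputable def cofSum (H : Matrix (Fin n) (Fin n) ℍ[ℝ]) (s : ℕ) : Matrix (Fin n) (Fin n) ℍ[ℝ] :=
  Matrix.of fun l j => ∑ α ∈ Finset.univ.powersetCard s, if l ∈ α ∧ j ∈ α then cof H α l j else 0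

theorem minorSum_eq (H : Matrix (Fin n) (Fin n) ℍ[ℝ]) (s : ℕ) :
    minorSum H s = ∑ α ∈ Finset.univ.powersetCard s, hdetOn H α := by
  rw [minorSum, Finset.sum_subtype (Finset.univ.powersetCard s)
    (p := fun α : Finset (Fin n) => α.card = s) (by simp [Finset.mem_powersetCard])]
  exact Finset.sum_congr rfl fun α _ => hdet_submatrix H α.1

theorem rdetSums_eq_mul (H : Matrix (Fin n) (Fin n) ℍ[ℝ]) (s : ℕ)
    (B : Matrix (Fin m) (Fin n) ℍ[ℝ]) : rdetSums H s B = B * cofSum H s := by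
  ext1 i j
  have h1 : rdetSums H s B i j = ∑ α ∈ (Finset.univ.powersetCard s).filter (fun α => j ∈ α),
      rdetOn (H.updateRow j (B i)) α j := by
    rw [rdetSums, Matrix.of_apply, Finset.sum_subtype _ (p := fun α : Finset (Fin n) => α.card = s ∧ j ∈ α)
      (by simp [Finset.mem_powersetCard])]
    exact Finset.sum_congr rfl fun (α : {α : Finset (Fin n) // α.card = s ∧ j ∈ α}) _ =>
      rdet_submatrix (H.updateRow j (B i)) (α := α.1) ⟨j, α.2.2⟩
  rw [h1, Matrix.mul_apply, Finset.sum_filter]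
  simp only [cofSum, Matrix.of_apply, Finset.mul_sum]
  rw [Finset.sum_comm]
  refine Finset.sum_congr rfl fun α _ => ?_
  split_ifs with hj
  · rw [rdetOn_updateRow H hj, ← Finset.sum_filter_add_sum_filter_not Finset.univ (· ∈ α),
      Finset.sum_eq_zero (s := Finset.univ.filter (¬ · ∈ α)), add_zero]
    · refine Finset.sum_congr (by ext; simp) fun l hl => ?_
      rw [if_pos ⟨(Finset.mem_filter.mp hl).2, hj⟩]
    · intro l hl
      simp at hl
      simp [hl]
  · simp [hj]

theorem cdetSums_eq_conjTranspose {H : Matrix (Fin n) (Fin n) ℍ[ℝ]} (hH : H.IsHermitian) (s : ℕ)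
    (C : Matrix (Fin n) (Fin m) ℍ[ℝ]) : cdetSums H s C = (rdetSums H s Cᴴ)ᴴ := by
  ext1 i j
  rw [Matrix.conjTranspose_apply, cdetSums, rdetSums, Matrix.of_apply, Matrix.of_apply, star_sum]
  refine Finset.sum_congr rfl fun α _ => ?_
  rw [cdet_eq_star_rdet]
  have : (principal (H.updateCol i fun l => C l j) α.1)ᴴ =
      principal (H.updateRow i fun l => Cᴴ j l) α.1 := by
    unfold principal
    rw [Matrix.conjTranspose_submatrix, ← Matrix.updateRow_conjTranspose, hH.eq]
    rfl
  rw [this]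

variable {H : Matrix (Fin n) (Fin n) ℍ[ℝ]}

theorem star_minorSum (hH : H.IsHermitian) (s : ℕ) : star (minorSum H s) = minorSum H s := by
  rw [minorSum_eq, star_sum]
  exact Finset.sum_congr rfl fun α _ => (cofactorLaws hH α).star_hdetOn

theorem isHermitian_cofSum (hH : H.IsHermitian) (s : ℕ) : (cofSum H s).IsHermitian := by
  ext1 l j
  rw [Matrix.conjTranspose_apply, cofSum, Matrix.of_apply, Matrix.of_apply, star_sum]
  refine Finset.sum_congr rfl fun α _ => ?_
  by_cases h : l ∈ α ∧ j ∈ α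
  · rw [if_pos h, if_pos h.symm, (cofactorLaws hH α).star_cof j h.2 l h.1]
  · rw [if_neg h, if_neg fun h' => h h'.symm, star_zero]

theorem cdetSums_eq_mul (hH : H.IsHermitian) (s : ℕ) (C : Matrix (Fin n) (Fin m) ℍ[ℝ]) :
    cdetSums H s C = cofSum H s * C := by
  rw [cdetSums_eq_conjTranspose hH, rdetSums_eq_mul, Matrix.conjTranspose_mul,
    Matrix.conjTranspose_conjTranspose, (isHermitian_cofSum hH s).eq]

theorem cofSum_zero (H : Matrix (Fin n) (Fin n) ℍ[ℝ]) : cofSum H 0 = 0 := by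
  ext1 l j
  simp [cofSum]

theorem minorSum_zero (H : Matrix (Fin n) (Fin n) ℍ[ℝ]) : minorSum H 0 = 1 := by
  simp [minorSum_eq, hdetOn_empty]

theorem minorSum_of_lt (H : Matrix (Fin n) (Fin n) ℍ[ℝ]) {s : ℕ} (h : n < s) :
    minorSum H s = 0 := by
  rw [minorSum_eq, Finset.powersetCard_eq_empty.mpr (by simpa using h), Finset.sum_empty]

theorem cofSum_of_lt (H : Matrix (Fin n) (Fin n) ℍ[ℝ]) {s : ℕ} (h : n < s) :
    cofSum H s = 0 := by
  ext1 l j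
  rw [cofSum, Matrix.of_apply, Finset.powersetCard_eq_empty.mpr (by simpa using h),
    Finset.sum_empty]
  rfl

theorem mul_cofSum_apply (H : Matrix (Fin n) (Fin n) ℍ[ℝ]) (s : ℕ) (i j : Fin n) :
    (H * cofSum H s) i j = ∑ α ∈ (Finset.univ.powersetCard s).filter (fun α => j ∈ α),
      ∑ l ∈ α, H i l * cof H α l j := by
  rw [Matrix.mul_apply, Finset.sum_filter]
  simp only [cofSum, Matrix.of_apply, Finset.mul_sum]
  rw [Finset.sum_comm]
  refine Finset.sum_congr rfl fun α _ => ?_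
  split_ifs with hj
  · simp [hj, mul_ite]
  · simp [hj]

theorem mul_cofSum_apply_self (hH : H.IsHermitian) (s : ℕ) (j : Fin n) :
    (H * cofSum H s) j j =
      ∑ α ∈ (Finset.univ.powersetCard s).filter (fun α => j ∈ α), hdetOn H α := by
  rw [mul_cofSum_apply]
  refine Finset.sum_congr rfl fun α hα => ?_
  have hj := (Finset.mem_filter.mp hα).2
  rw [(cofactorLaws hH α).sum_mul_cof j hj j hj, if_pos rfl]

theorem sum_powersetCard_succ_mem {M : Type*} [AddCommMonoid M] (s : ℕ) (i : Fin n)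
    (p : Finset (Fin n) → Prop) [DecidablePred p] (hp : ∀ α, p (α.erase i) ↔ p α)
    (f : Finset (Fin n) → M) :
    ∑ α ∈ (Finset.univ.powersetCard (s + 1)).filter (fun α => i ∈ α ∧ p α), f (α.erase i) =
      ∑ β ∈ (Finset.univ.powersetCard s).filter (fun β => i ∉ β ∧ p β), f β := by
  refine Finset.sum_bij' (fun α _ => α.erase i) (fun β _ => insert i β) ?_ ?_ ?_ ?_ ?_
  · intro α hα
    simp only [Finset.mem_filter, Finset.mem_powersetCard, Finset.subset_univ, true_and] at hα ⊢
    refine ⟨?_, Finset.notMem_erase i α, (hp α).mpr hα.2.2⟩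
    rw [Finset.card_erase_of_mem hα.2.1, hα.1, Nat.add_sub_cancel]
  · intro β hβ
    simp only [Finset.mem_filter, Finset.mem_powersetCard, Finset.subset_univ, true_and] at hβ ⊢
    refine ⟨?_, Finset.mem_insert_self i β, ?_⟩
    · rw [Finset.card_insert_of_notMem hβ.2.1, hβ.1]
    · rw [← hp, Finset.erase_insert hβ.2.1]
      exact hβ.2.2
  · intro α hα
    exact Finset.insert_erase (Finset.mem_filter.mp hα).2.1
  · intro β hβ
    exact Finset.erase_insert (Finset.mem_filter.mp hβ).2.1
  · intro α _
    rfl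

/-- On the diagonal, sets containing i contribute through H M_s, and sets avoiding i through
M_{s+1}, by adding i to them. Off the diagonal, sets containing both indices contribute zero by the
cofactor laws; those containing j but not i cancel against M_{s+1} by the row expansion. -/
theorem mul_cofSum_add (hH : H.IsHermitian) (s : ℕ) :
    H * cofSum H s + cofSum H (s + 1) = Matrix.scalar (Fin n) (minorSum H s) := by
  ext1 i j
  rw [Matrix.add_apply]
  by_cases hij : i = j
  · subst hij
    rw [mul_cofSum_apply_self hH, Matrix.scalar_apply, Matrix.diagonal_apply_eq, minorSum_eq,
      ← Finset.sum_filter_add_sum_filter_not (Finset.univ.powersetCard s) (fun α => i ∈ α)]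
    congr 1
    have h := sum_powersetCard_succ_mem s i (fun _ => True) (fun _ => Iff.rfl) (hdetOn H)
    simp only [and_true] at h
    rw [← h, Finset.sum_filter, cofSum, Matrix.of_apply]
    refine Finset.sum_congr rfl fun α _ => ?_
    simp only [and_self, cof_self]
  · rw [Matrix.scalar_apply, Matrix.diagonal_apply_ne _ hij, mul_cofSum_apply,
      ← Finset.sum_filter_add_sum_filter_not _ (fun α => i ∈ α),
      Finset.sum_eq_zero, zero_add]
    · have h := sum_powersetCard_succ_mem s i (fun α => j ∈ α)
        (fun α => by simp [Ne.symm hij]) (fun β => ∑ l ∈ β, H i l * cof H β l j)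
      rw [Finset.filter_filter]
      simp only [and_comm (a := j ∈ _)]
      rw [← h, cofSum, Matrix.of_apply, ← Finset.sum_filter, ← Finset.sum_add_distrib]
      refine Finset.sum_eq_zero fun α hα => ?_
      rw [cof_of_ne_eq_sum H (Finset.mem_filter.mp hα).2.2 hij, add_neg_cancel]
    · intro α hα
      simp only [Finset.mem_filter] at hα
      rw [(cofactorLaws hH α).sum_mul_cof i hα.2 j hα.1.2, if_neg hij]

theorem trace_mul_cofSum (hH : H.IsHermitian) (s : ℕ) :
    (H * cofSum H s).trace = s * minorSum H s := by
  unfold Matrix.trace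
  simp only [Matrix.diag_apply, mul_cofSum_apply_self hH]
  rw [minorSum_eq, Finset.mul_sum]
  simp only [Finset.sum_filter]
  rw [Finset.sum_comm]
  refine Finset.sum_congr rfl fun α hα => ?_
  rw [← Finset.sum_filter, Finset.sum_const, Finset.filter_univ_mem,
    (Finset.mem_powersetCard.mp hα).2, nsmul_eq_mul]

end MinorSums

/-! ### Rank of a Hermitian matrix through its minor sums -/

section Rank

open scoped Quaternion

variable {l m n : ℕ}

theorem re_sum {ι : Type*} (s : Finset ι) (f : ι → ℍ[ℝ]) : (∑ i ∈ s, f i).re = ∑ i ∈ s, (f i).re :=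
  map_sum (QuaternionAlgebra.reₗ (-1 : ℝ) 0 (-1)) f s

theorem eq_zero_of_conjTranspose_mul_self {X : Matrix (Fin m) (Fin n) ℍ[ℝ]} (h : Xᴴ * X = 0) :
    X = 0 := by
  ext1 i j
  have h1 : (∑ k, star (X k j) * X k j).re = 0 := by
    rw [show ∑ k, star (X k j) * X k j = 0 from congrFun (congrFun h j) j]
    rfl
  simp only [re_sum, Quaternion.star_mul_self, Quaternion.re_coe] at h1
  rw [Finset.sum_eq_zero_iff_of_nonneg fun _ _ => Quaternion.normSq_nonneg] at h1
  exact Quaternion.normSq_eq_zero.mp (h1 i (Finset.mem_univ i))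

theorem mul_eq_zero_of_conjTranspose_mul_mul {A : Matrix (Fin m) (Fin n) ℍ[ℝ]}
    {Y : Matrix (Fin n) (Fin l) ℍ[ℝ]} (h : Aᴴ * A * Y = 0) : A * Y = 0 := by
  apply eq_zero_of_conjTranspose_mul_self
  rw [Matrix.conjTranspose_mul, Matrix.mul_assoc, ← Matrix.mul_assoc Aᴴ, h, Matrix.mul_zero]

/-- If H^(q+2) X = 0, then (H^(q+1))ᴴ H^(q+1) X = 0, so the exponent drops by one each time. -/
theorem mul_eq_zero_of_pow_mul {H : Matrix (Fin n) (Fin n) ℍ[ℝ]} (hH : H.IsHermitian)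
    {X : Matrix (Fin n) (Fin l) ℍ[ℝ]} (q : ℕ) (h : H ^ q * X = 0) : H * X = 0 := by
  induction q with
  | zero => rw [pow_zero, Matrix.one_mul] at h; rw [h, Matrix.mul_zero]
  | succ q ih =>
    rcases q with _ | q
    · rwa [zero_add, pow_one] at h
    · apply ih
      have h1 : (H ^ (q + 1))ᴴ = H ^ (q + 1) := by rw [Matrix.conjTranspose_pow, hH.eq]
      apply mul_eq_zero_of_conjTranspose_mul_mul
      rw [h1, ← pow_add, show q + 1 + (q + 1) = q + (q + 1 + 1) by ring, pow_add, Matrix.mul_assoc,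
        h, Matrix.mul_zero]

/-- Over the quaternions only the real part of the trace is cyclic, because re(ab) = re(ba). -/
theorem re_trace_mul_comm (X : Matrix (Fin m) (Fin n) ℍ[ℝ]) (Y : Matrix (Fin n) (Fin m) ℍ[ℝ]) :
    (X * Y).trace.re = (Y * X).trace.re := by
  simp only [Matrix.trace, Matrix.diag_apply, Matrix.mul_apply, re_sum]
  rw [Finset.sum_comm]
  refine Finset.sum_congr rfl fun i _ => Finset.sum_congr rfl fun j _ => ?_
  simp only [Quaternion.re_mul]
  ring

theorem mem_rowSpan_iff {A : Matrix (Fin m) (Fin n) ℍ[ℝ]} {v : Fin n → ℍ[ℝ]} :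
    v ∈ Submodule.span ℍ[ℝ] (Set.range fun i => A i) ↔ ∃ z : Fin m → ℍ[ℝ], z ᵥ* A = v := by
  rw [Submodule.mem_span_range_iff_exists_fun]
  refine exists_congr fun z => ?_
  rw [Matrix.vecMul_eq_sum]

theorem exists_mul_eq_iff {A : Matrix (Fin m) (Fin n) ℍ[ℝ]} {B : Matrix (Fin l) (Fin n) ℍ[ℝ]} :
    (∃ Z : Matrix (Fin l) (Fin m) ℍ[ℝ], Z * A = B) ↔
      Submodule.span ℍ[ℝ] (Set.range fun i => B i) ≤
        Submodule.span ℍ[ℝ] (Set.range fun i => A i) := by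
  rw [Submodule.span_le]
  constructor
  · rintro ⟨Z, rfl⟩ _ ⟨i, rfl⟩
    exact mem_rowSpan_iff.mpr ⟨Z i, rfl⟩
  · intro h
    choose Z hZ using fun i => mem_rowSpan_iff.mp (h ⟨i, rfl⟩)
    exact ⟨Matrix.of Z, funext hZ⟩

theorem rk_mul_le (Z : Matrix (Fin l) (Fin m) ℍ[ℝ]) (A : Matrix (Fin m) (Fin n) ℍ[ℝ]) :
    rk (Z * A) ≤ rk A :=
  Submodule.finrank_mono (exists_mul_eq_iff.mp ⟨Z, rfl⟩)

theorem rk_eq_of_mul_eq {A : Matrix (Fin m) (Fin n) ℍ[ℝ]} {B : Matrix (Fin l) (Fin n) ℍ[ℝ]}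
    {Y : Matrix (Fin m) (Fin l) ℍ[ℝ]} {Z : Matrix (Fin l) (Fin m) ℍ[ℝ]} (hA : Y * B = A)
    (hB : Z * A = B) : rk A = rk B :=
  le_antisymm (hA ▸ rk_mul_le Y B) (hB ▸ rk_mul_le Z A)

theorem exists_mul_eq_of_rk_eq {Z : Matrix (Fin l) (Fin m) ℍ[ℝ]} {A : Matrix (Fin m) (Fin n) ℍ[ℝ]}
    (h : rk (Z * A) = rk A) : ∃ Y : Matrix (Fin m) (Fin l) ℍ[ℝ], Y * (Z * A) = A :=
  exists_mul_eq_iff.mpr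
    (Submodule.eq_of_le_of_finrank_eq (exists_mul_eq_iff.mp ⟨Z, rfl⟩) h).ge

/-- Factor Q = FG with the rows of G a basis of the row space. Idempotence gives GQ = G, hence GF =
1, and the real trace of FG is that of GF. -/
theorem re_trace_eq_rk {Q : Matrix (Fin n) (Fin n) ℍ[ℝ]} (hQ : Q * Q = Q) :
    Q.trace.re = rk Q := by
  let V := Submodule.span ℍ[ℝ] (Set.range fun i => Q i)
  let b : Module.Basis (Fin (rk Q)) ℍ[ℝ] V := Module.finBasis ℍ[ℝ] V
  let G : Matrix (Fin (rk Q)) (Fin n) ℍ[ℝ] := Matrix.of fun a => (b a : Fin n → ℍ[ℝ])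
  let F : Matrix (Fin n) (Fin (rk Q)) ℍ[ℝ] :=
    Matrix.of fun i => b.repr ⟨Q i, Submodule.subset_span ⟨i, rfl⟩⟩
  have hFG : F * G = Q := by
    funext i
    have h := congrArg Subtype.val (b.sum_repr ⟨Q i, Submodule.subset_span ⟨i, rfl⟩⟩)
    rw [Submodule.coe_sum] at h
    show F i ᵥ* G = Q i
    rw [Matrix.vecMul_eq_sum]
    exact h
  obtain ⟨Z, hZ⟩ : ∃ Z : Matrix (Fin (rk Q)) (Fin n) ℍ[ℝ], Z * Q = G := by
    rw [exists_mul_eq_iff, Submodule.span_le]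
    rintro _ ⟨a, rfl⟩
    exact (b a).2
  have hind : LinearIndependent ℍ[ℝ] fun a => G a := b.linearIndependent.map' V.subtype (by simp)
  have hGF : G * F = 1 := by
    have h0 : (G * F - 1) * G = 0 := by
      rw [Matrix.sub_mul, Matrix.mul_assoc, hFG, Matrix.one_mul, ← hZ, Matrix.mul_assoc, hQ,
        sub_self]
    rw [← sub_eq_zero]
    ext1 a c
    have h1 : ∑ c, (G * F - 1 : Matrix _ _ ℍ[ℝ]) a c • G c = 0 :=
      (Matrix.vecMul_eq_sum ((G * F - 1 : Matrix _ _ ℍ[ℝ]) a) G).symm.trans (congrFun h0 a)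
    exact Fintype.linearIndependent_iff.mp hind _ h1 c
  rw [← hFG, re_trace_mul_comm, hGF, hFG, Matrix.trace_one, Fintype.card_fin]
  simp

variable {H : Matrix (Fin n) (Fin n) ℍ[ℝ]}

theorem minorSum_eq_coe (hH : H.IsHermitian) (s : ℕ) : minorSum H s = ((minorSum H s).re : ℍ[ℝ]) :=
  Quaternion.star_eq_self.mp (star_minorSum hH s)

theorem cofSum_succ (hH : H.IsHermitian) (s : ℕ) :
    cofSum H (s + 1) = (minorSum H s).re • 1 - H * cofSum H s := by
  rw [eq_sub_iff_add_eq', mul_cofSum_add hH, minorSum_eq_coe hH]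
  ext1 i j
  rw [Matrix.scalar_apply, Matrix.smul_apply, Matrix.diagonal_apply, Matrix.one_apply, smul_ite,
    smul_zero, Quaternion.re_coe, ← Quaternion.algebraMap_def, Algebra.algebraMap_eq_smul_one]

theorem re_trace_mul_cofSum (hH : H.IsHermitian) (s : ℕ) :
    (H * cofSum H s).trace.re = s * (minorSum H s).re := by
  rw [trace_mul_cofSum hH, minorSum_eq_coe hH, ← Quaternion.coe_natCast, ← Quaternion.coe_mul,
    Quaternion.re_coe, Quaternion.re_coe]

theorem commute_cofSum (hH : H.IsHermitian) {Y : Matrix (Fin n) (Fin n) ℍ[ℝ]} (hY : Commute Y H)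
    (s : ℕ) : Commute Y (cofSum H s) := by
  induction s with
  | zero => rw [cofSum_zero]; exact Commute.zero_right _
  | succ s ih =>
    rw [cofSum_succ hH]
    exact ((Commute.one_right _).smul_right _).sub_right (hY.mul_right ih)

/-- Take q to be the largest size with d_q ≠ 0. Beyond it the recursion reads M_{s+1} = -H M_s, and
M_s = 0 for s > n. So H^n M_{q+1} = 0, and a Hermitian H allows the exponent to be lowered to 1. -/
theorem exists_minorSum_ne_zero (hH : H.IsHermitian) :
    ∃ q, (minorSum H q).re ≠ 0 ∧ H * cofSum H (q + 1) = 0 := by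
  classical
  let q := Nat.findGreatest (fun s => (minorSum H s).re ≠ 0) n
  have h0 : (minorSum H q).re ≠ 0 := by
    apply Nat.findGreatest_spec (P := fun s => (minorSum H s).re ≠ 0) (Nat.zero_le n)
    rw [minorSum_zero]
    simp
  have h1 : ∀ s, q < s → (minorSum H s).re = 0 := by
    intro s hs
    by_cases hsn : s ≤ n
    · by_contra h
      exact Nat.findGreatest_is_greatest hs hsn h
    · rw [minorSum_of_lt H (not_le.mp hsn)]
      rfl
  refine ⟨q, h0, ?_⟩
  have h2 : ∀ t, cofSum H (q + 1 + t) = (-1) ^ t * (H ^ t * cofSum H (q + 1)) := by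
    intro t
    induction t with
    | zero => simp
    | succ t ih =>
      rw [← add_assoc, cofSum_succ hH, h1 _ (by omega), zero_smul, zero_sub, ih, pow_succ, pow_succ']
      rw [mul_neg_one, neg_mul, neg_inj, ← mul_assoc, ← mul_assoc, ← mul_assoc, ← mul_assoc,
        ((Commute.neg_one_right H).pow_right t).eq]
  apply mul_eq_zero_of_pow_mul hH n
  have h3 := h2 n
  rw [cofSum_of_lt H (by omega)] at h3
  rcases neg_one_pow_eq_or (Matrix (Fin n) (Fin n) ℍ[ℝ]) n with h | h
  · rw [h, one_mul] at h3; exact h3.symm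
  · rw [h, neg_one_mul] at h3; exact neg_eq_zero.mp h3.symm

theorem mul_mul_cofSum_of_mul_eq_zero (hH : H.IsHermitian) {q : ℕ}
    (hq : H * cofSum H (q + 1) = 0) : H * (H * cofSum H q) = (minorSum H q).re • H := by
  rw [cofSum_succ hH, mul_sub, mul_smul_comm, mul_one, sub_eq_zero] at hq
  exact hq.symm

/-- The matrix d_q⁻¹ H M_q is an idempotent with the row space of H, so its real trace is rk H; by
the trace identity it is also q. -/
theorem eq_rk_of_minorSum_ne_zero (hH : H.IsHermitian) {q : ℕ} (h0 : (minorSum H q).re ≠ 0)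
    (hq : H * cofSum H (q + 1) = 0) : rk H = q := by
  have h1 := mul_mul_cofSum_of_mul_eq_zero hH hq
  have hc := commute_cofSum hH (Commute.refl H) q
  have hQH : H * ((minorSum H q).re⁻¹ • (H * cofSum H q)) = H := by
    rw [mul_smul_comm, h1, smul_smul, inv_mul_cancel₀ h0, one_smul]
  have hQ : (minorSum H q).re⁻¹ • (H * cofSum H q) =
      ((minorSum H q).re⁻¹ • cofSum H q) * H := by
    rw [smul_mul_assoc, hc.eq]
  have hidem : ((minorSum H q).re⁻¹ • (H * cofSum H q)) *
      ((minorSum H q).re⁻¹ • (H * cofSum H q)) = (minorSum H q).re⁻¹ • (H * cofSum H q) := by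
    nth_rw 1 [hQ]
    rw [mul_assoc, hQH, ← hQ]
  have hrk := rk_eq_of_mul_eq hQH hQ.symm
  have htr := re_trace_eq_rk hidem
  rw [← hrk, Matrix.trace_smul, Quaternion.re_smul, re_trace_mul_cofSum hH, smul_eq_mul,
    mul_left_comm, inv_mul_cancel₀ h0, mul_one] at htr
  exact_mod_cast htr.symm

theorem re_minorSum_rk_ne_zero (hH : H.IsHermitian) : (minorSum H (rk H)).re ≠ 0 := by
  obtain ⟨q, h0, hq⟩ := exists_minorSum_ne_zero hH
  rwa [eq_rk_of_minorSum_ne_zero hH h0 hq]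

theorem mul_cofSum_rk_succ (hH : H.IsHermitian) : H * cofSum H (rk H + 1) = 0 := by
  obtain ⟨q, h0, hq⟩ := exists_minorSum_ne_zero hH
  rwa [eq_rk_of_minorSum_ne_zero hH h0 hq]

theorem mul_mul_cofSum_rk (hH : H.IsHermitian) :
    H * (H * cofSum H (rk H)) = (minorSum H (rk H)).re • H :=
  mul_mul_cofSum_of_mul_eq_zero hH (mul_cofSum_rk_succ hH)

end Rank

/-! ### The two Gram matrices of A -/

section Gram

open scoped Quaternion

variable {m n : ℕ} (A : Matrix (Fin m) (Fin n) ℍ[ℝ])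

/-- The claims feed each other: equal minor sums at s give the intertwining at s + 1 through the
recursion, and this gives equal minor sums at s + 1 through the real trace. -/
theorem mul_cofSum_gram_and (s : ℕ) : A * cofSum (Aᴴ * A) s = cofSum (A * Aᴴ) s * A ∧
    (minorSum (Aᴴ * A) s).re = (minorSum (A * Aᴴ) s).re := by
  have h1 := Matrix.isHermitian_conjTranspose_mul_self A
  have h2 := Matrix.isHermitian_mul_conjTranspose_self A
  induction s with
  | zero => simp [cofSum_zero, minorSum_zero]
  | succ s ih =>
    have h3 : A * cofSum (Aᴴ * A) (s + 1) = cofSum (A * Aᴴ) (s + 1) * A := by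
      rw [cofSum_succ h1, cofSum_succ h2, ih.2, Matrix.mul_sub, Matrix.sub_mul, Matrix.mul_smul,
        Matrix.smul_mul, Matrix.mul_one, Matrix.one_mul]
      simp only [Matrix.mul_assoc]
      rw [ih.1]
    refine ⟨h3, ?_⟩
    have h4 := re_trace_mul_cofSum h1 (s + 1)
    rw [Matrix.mul_assoc, h3, re_trace_mul_comm, Matrix.mul_assoc,
      (commute_cofSum h2 (Commute.refl _) (s + 1)).symm.eq, re_trace_mul_cofSum h2] at h4
    have h5 : ((s + 1 : ℕ) : ℝ) ≠ 0 := by positivity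
    exact (mul_left_cancel₀ h5 h4).symm

theorem mul_cofSum_gram (s : ℕ) : A * cofSum (Aᴴ * A) s = cofSum (A * Aᴴ) s * A :=
  (mul_cofSum_gram_and A s).1

theorem minorSum_gram (s : ℕ) : minorSum (Aᴴ * A) s = minorSum (A * Aᴴ) s := by
  rw [minorSum_eq_coe (Matrix.isHermitian_conjTranspose_mul_self A),
    minorSum_eq_coe (Matrix.isHermitian_mul_conjTranspose_self A), (mul_cofSum_gram_and A s).2]

theorem mul_mul_cofSum_gram :
    A * (Aᴴ * A * cofSum (Aᴴ * A) (rk (Aᴴ * A))) = (minorSum (Aᴴ * A) (rk (Aᴴ * A))).re • A := by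
  have h1 := Matrix.isHermitian_conjTranspose_mul_self A
  have h := mul_eq_zero_of_conjTranspose_mul_mul (mul_cofSum_rk_succ h1)
  rw [cofSum_succ h1, Matrix.mul_sub, Matrix.mul_smul, Matrix.mul_one, sub_eq_zero] at h
  exact h.symm

theorem rk_conjTranspose_mul : rk (Aᴴ * A) = rk A := by
  have h1 := Matrix.isHermitian_conjTranspose_mul_self A
  have h0 := re_minorSum_rk_ne_zero h1
  refine rk_eq_of_mul_eq (Y := Aᴴ) (Z := (minorSum (Aᴴ * A) (rk (Aᴴ * A))).re⁻¹ •
    (A * cofSum (Aᴴ * A) (rk (Aᴴ * A)))) rfl ?_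
  rw [Matrix.smul_mul, Matrix.mul_assoc, ← (commute_cofSum h1 (Commute.refl _) _).eq,
    mul_mul_cofSum_gram, smul_smul, inv_mul_cancel₀ h0, one_smul]

end Gram

/-! ### The Moore–Penrose inverse and its projections -/

section MoorePenrose

open scoped Quaternion

variable {m n : ℕ} (A : Matrix (Fin m) (Fin n) ℍ[ℝ])

/-- The inverse is P Aᴴ, where P = d⁻¹ M at the rank of AᴴA. This P is Hermitian, commutes with AᴴA
and satisfies A(AᴴAP) = A. -/
theorem exists_isMoorePenrose : ∃ X, IsMoorePenrose A X := by
  have h1 := Matrix.isHermitian_conjTranspose_mul_self A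
  have h0 := re_minorSum_rk_ne_zero h1
  have h2 := mul_mul_cofSum_gram A
  have hc := (commute_cofSum h1 (Commute.refl _) (rk (Aᴴ * A))).eq
  have hM := isHermitian_cofSum h1 (rk (Aᴴ * A))
  generalize (minorSum (Aᴴ * A) (rk (Aᴴ * A))).re = c at *
  generalize cofSum (Aᴴ * A) (rk (Aᴴ * A)) = M at *
  obtain ⟨P, hP⟩ : ∃ P, P = c⁻¹ • M := ⟨_, rfl⟩
  have hPH : Pᴴ = P := by
    ext1 i j
    rw [hP, Matrix.conjTranspose_apply, Matrix.smul_apply, Matrix.smul_apply, Quaternion.star_smul,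
      hM.apply]
  have hcP : Aᴴ * A * P = P * (Aᴴ * A) := by
    rw [hP, Matrix.mul_smul, Matrix.smul_mul, hc]
  have hA : A * (Aᴴ * A * P) = A := by
    rw [hP, Matrix.mul_smul, Matrix.mul_smul, h2, smul_smul, inv_mul_cancel₀ h0, one_smul]
  have hA' : P * (Aᴴ * A) * Aᴴ = Aᴴ := by
    have := congrArg Matrix.conjTranspose hA
    rwa [Matrix.conjTranspose_mul, Matrix.conjTranspose_mul, h1.eq, hPH] at this
  refine ⟨P * Aᴴ, ?_, ?_, ?_, ?_⟩
  · rw [Matrix.mul_assoc, Matrix.mul_assoc, ← hcP, hA]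
  · calc P * Aᴴ * A * (P * Aᴴ) = P * (Aᴴ * A * P) * Aᴴ := by simp only [Matrix.mul_assoc]
      _ = P * Aᴴ := by rw [hcP, Matrix.mul_assoc, hA']
  · simp only [Matrix.conjTranspose_mul, Matrix.conjTranspose_conjTranspose, hPH, Matrix.mul_assoc]
  · rw [Matrix.mul_assoc, Matrix.conjTranspose_mul, h1.eq, hPH, hcP]

variable {A}

theorem IsMoorePenrose.eq {X Y : Matrix (Fin n) (Fin m) ℍ[ℝ]} (hX : IsMoorePenrose A X)
    (hY : IsMoorePenrose A Y) : X = Y := by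
  obtain ⟨x1, x2, x3, x4⟩ := hX
  obtain ⟨y1, y2, y3, y4⟩ := hY
  have h1 : A * X = A * Y := by
    calc A * X = (A * Y)ᴴ * (A * X)ᴴ := by rw [x3, y3, ← Matrix.mul_assoc, y1]
      _ = A * Y := by rw [← Matrix.conjTranspose_mul, ← Matrix.mul_assoc, x1, y3]
  have h2 : X * A = Y * A := by
    calc X * A = (X * A)ᴴ * (Y * A)ᴴ := by
          rw [x4, y4, Matrix.mul_assoc, ← Matrix.mul_assoc A, y1]
      _ = Y * A := by
          rw [← Matrix.conjTranspose_mul, Matrix.mul_assoc, ← Matrix.mul_assoc A, x1, y4]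
  rw [← x2, Matrix.mul_assoc, h1, ← Matrix.mul_assoc, h2, y2]

theorem isMoorePenrose_mpInv (A : Matrix (Fin m) (Fin n) ℍ[ℝ]) : IsMoorePenrose A (mpInv A) := by
  rw [mpInv, dif_pos (exists_isMoorePenrose A)]
  exact (exists_isMoorePenrose A).choose_spec

theorem mpInv_mul_mul_conjTranspose (A : Matrix (Fin m) (Fin n) ℍ[ℝ]) :
    mpInv A * A * Aᴴ = Aᴴ := by
  obtain ⟨h1, _, _, h4⟩ := isMoorePenrose_mpInv A
  rw [← h4, ← Matrix.conjTranspose_mul, ← Matrix.mul_assoc, h1]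

theorem conjTranspose_mul_mul_mpInv (A : Matrix (Fin m) (Fin n) ℍ[ℝ]) :
    Aᴴ * (A * mpInv A) = Aᴴ := by
  obtain ⟨h1, _, h3, _⟩ := isMoorePenrose_mpInv A
  rw [← h3, ← Matrix.conjTranspose_mul, h1]

theorem cofSum_gram_mul (A : Matrix (Fin m) (Fin n) ℍ[ℝ]) :
    cofSum (Aᴴ * A) (rk A) * (Aᴴ * A) = (minorSum (Aᴴ * A) (rk A)).re • (mpInv A * A) := by
  have h1 := Matrix.isHermitian_conjTranspose_mul_self A
  have h2 := mul_mul_cofSum_gram A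
  rw [rk_conjTranspose_mul] at h2
  rw [← (commute_cofSum h1 (Commute.refl _) (rk A)).eq, ← Matrix.mul_smul, ← h2,
    ← Matrix.mul_assoc, ← Matrix.mul_assoc, ← Matrix.mul_assoc, mpInv_mul_mul_conjTranspose]

theorem mul_cofSum_mul_conjTranspose (A : Matrix (Fin m) (Fin n) ℍ[ℝ]) :
    A * Aᴴ * cofSum (A * Aᴴ) (rk A) = (minorSum (Aᴴ * A) (rk A)).re • (A * mpInv A) := by
  have h2 := Matrix.isHermitian_mul_conjTranspose_self A
  have h1 := (isMoorePenrose_mpInv A).1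
  calc A * Aᴴ * cofSum (A * Aᴴ) (rk A)
      = A * cofSum (Aᴴ * A) (rk A) * (Aᴴ * (A * mpInv A)) := by
        rw [(commute_cofSum h2 (Commute.refl _) _).eq, ← Matrix.mul_assoc, ← mul_cofSum_gram,
          conjTranspose_mul_mul_mpInv]
    _ = A * (cofSum (Aᴴ * A) (rk A) * (Aᴴ * A)) * mpInv A := by simp only [Matrix.mul_assoc]
    _ = (minorSum (Aᴴ * A) (rk A)).re • (A * mpInv A) := by
        rw [cofSum_gram_mul, Matrix.mul_smul, Matrix.smul_mul, ← Matrix.mul_assoc, h1]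

end MoorePenrose

/-! ### Index, Drazin inverse and weighted Drazin inverse -/

section Drazin

open scoped Quaternion Polynomial

variable {m n : ℕ}

/-- The set defining the index has to be nonempty, since `sInf` of the empty set is 0. If it were
empty, the ranks of the powers would decrease strictly forever. -/
theorem ind_spec (B : Matrix (Fin n) (Fin n) ℍ[ℝ]) :
    0 < ind B ∧ rk (B ^ (ind B + 1)) = rk (B ^ ind B) := by
  apply Nat.sInf_mem (s := {k : ℕ | 0 < k ∧ rk (B ^ (k + 1)) = rk (B ^ k)})
  by_contra h
  rw [Set.not_nonempty_iff_eq_empty] at h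
  have h1 : ∀ k, rk (B ^ (k + 1 + 1)) < rk (B ^ (k + 1)) := by
    intro k
    refine lt_of_le_of_ne ?_ fun heq => ?_
    · rw [pow_succ' B (k + 1)]
      exact rk_mul_le B _
    · exact Set.eq_empty_iff_forall_notMem.mp h (k + 1) ⟨by omega, heq⟩
  have h2 : ∀ k, rk (B ^ (k + 1)) + k ≤ rk (B ^ 1) := by
    intro k
    induction k with
    | zero => simp
    | succ k ih => have := h1 k; omega
  have := h2 (rk (B ^ 1) + 1)
  omega

/-- B is integral over ℝ. Write an annihilating polynomial as X^a q with q(0) ≠ 0; then G is -q(0)⁻¹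
(q - q(0))/X evaluated at B. -/
theorem exists_pow_eq_pow_succ_mul {S : Type*} [Ring S] [Algebra ℝ S] [Module.Finite ℝ S] (B : S) :
    ∃ (a : ℕ) (G : S), Commute B G ∧ B ^ a = B ^ a * (B * G) := by
  obtain ⟨p, hp, hpB⟩ := Algebra.IsIntegral.isIntegral (R := ℝ) B
  obtain ⟨q, hq, hqX⟩ := Polynomial.exists_eq_pow_rootMultiplicity_mul_and_not_dvd p hp.ne_zero 0
  rw [Polynomial.C_0, sub_zero] at hq hqX
  generalize Polynomial.rootMultiplicity 0 p = a at hq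
  have hq0 : q.coeff 0 ≠ 0 := fun h => hqX (Polynomial.X_dvd_iff.mpr h)
  have h1 : B ^ a * (Polynomial.aeval B q.divX * B + algebraMap ℝ S (q.coeff 0)) = 0 := by
    have h2 : Polynomial.aeval B p = 0 := hpB
    rw [hq, ← Polynomial.divX_mul_X_add q] at h2
    simpa using h2
  have hcomm : Commute B (Polynomial.aeval B q.divX) := by
    have := (Commute.all Polynomial.X q.divX).map (Polynomial.aeval B)
    rwa [Polynomial.aeval_X] at this
  refine ⟨a, -((q.coeff 0)⁻¹ • Polynomial.aeval B q.divX), (hcomm.smul_right _).neg_right, ?_⟩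
  rw [mul_add, add_eq_zero_iff_neg_eq, Algebra.algebraMap_eq_smul_one, mul_smul_comm, mul_one] at h1
  rw [mul_neg, mul_smul_comm, mul_neg, mul_smul_comm, hcomm.eq, ← smul_neg, h1, smul_smul,
    inv_mul_cancel₀ hq0, one_smul]

/-- `Y` is the Drazin inverse of `B`, `l` being an upper bound for the index of `B`. -/
structure IsDrazin {S : Type*} [Ring S] (B : S) (l : ℕ) (Y : S) : Prop where
  comm : Commute B Y
  mul_mul : Y * (B * Y) = Y
  pow_mul : B ^ (l + 1) * Y = B ^ l

theorem IsDrazin.mono {S : Type*} [Ring S] {B Y : S} {l k : ℕ} (h : IsDrazin B l Y) (hk : l ≤ k) :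
    IsDrazin B k Y := by
  refine ⟨h.comm, h.mul_mul, ?_⟩
  obtain ⟨t, rfl⟩ := Nat.exists_eq_add_of_le' hk
  rw [add_assoc, pow_add, mul_assoc, h.pow_mul, ← pow_add]

theorem IsDrazin.pow_mul_pow {S : Type*} [Ring S] {B Y : S} {l : ℕ} (h : IsDrazin B l Y) (s : ℕ) :
    B ^ s * Y ^ (s + 1) = Y := by
  induction s with
  | zero => simp
  | succ s ih =>
    rw [pow_succ B, pow_succ' Y, mul_assoc, ← mul_assoc B, (h.comm.mul_left (Commute.refl Y)).pow_right
      (s + 1) |>.eq, ← mul_assoc, ih, h.mul_mul]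

theorem IsDrazin.eq {S : Type*} [Ring S] {B Y Z : S} {l : ℕ} (hY : IsDrazin B l Y)
    (hZ : IsDrazin B l Z) : Y = Z := by
  have h1 : Y = Y * (B * Z) := by
    calc Y = Y ^ (l + 1) * B ^ l := by
          rw [← (hY.comm.pow_pow l (l + 1)).eq, hY.pow_mul_pow]
      _ = (Y ^ (l + 1) * B ^ l) * (B * Z) := by
          nth_rw 1 [← hZ.pow_mul]
          rw [pow_succ B]
          simp only [mul_assoc]
      _ = Y * (B * Z) := by rw [← (hY.comm.pow_pow l (l + 1)).eq, hY.pow_mul_pow]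
  have h2 : Z = Y * (B * Z) := by
    calc Z = B ^ l * Z ^ (l + 1) := (hZ.pow_mul_pow l).symm
      _ = Y * B * (B ^ l * Z ^ (l + 1)) := by
          nth_rw 1 [← hY.pow_mul]
          rw [(hY.comm.pow_left (l + 1)).eq, pow_succ' B]
          simp only [mul_assoc]
      _ = Y * (B * Z) := by rw [hZ.pow_mul_pow, mul_assoc]
  rw [h1, ← h2]

/-- G inverts B only after multiplication by B^a, and a may exceed the index l. Stable rank gives
B^l = Z^N B^(l+N), which transfers the relation from a to l. The Drazin inverse is then B^l G^(l+1).
-/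
theorem exists_isDrazin (B : Matrix (Fin n) (Fin n) ℍ[ℝ]) : ∃ Y, IsDrazin B (ind B) Y := by
  obtain ⟨a, G, hG, ha⟩ := exists_pow_eq_pow_succ_mul B
  have hl := (ind_spec B).2
  generalize ind B = l at hl
  rw [pow_succ'] at hl
  obtain ⟨Z, hZ⟩ := exists_mul_eq_of_rk_eq hl
  rw [← pow_succ'] at hZ
  have hZN : ∀ N, Z ^ N * B ^ (l + N) = B ^ l := by
    intro N
    induction N with
    | zero => simp
    | succ N ih =>
      rw [pow_succ, show l + (N + 1) = l + 1 + N by ring, pow_add B (l + 1), mul_assoc,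
        ← mul_assoc Z, hZ, ← pow_add, ih]
  have h1 : B ^ l * (B * G) = B ^ l := by
    nth_rw 1 [← hZN a]
    rw [pow_add, mul_assoc, mul_assoc, ← ha, ← pow_add, hZN]
  have h2 : ∀ t, B ^ l * (B ^ t * G ^ t) = B ^ l := by
    intro t
    rw [← hG.mul_pow]
    induction t with
    | zero => simp
    | succ t ih => rw [pow_succ', ← mul_assoc, h1, ih]
  have hc : Commute B (B ^ l * G ^ (l + 1)) :=
    ((Commute.refl B).pow_right l).mul_right (hG.pow_right _)
  refine ⟨B ^ l * G ^ (l + 1), hc, ?_, ?_⟩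
  · calc B ^ l * G ^ (l + 1) * (B * (B ^ l * G ^ (l + 1)))
        = G ^ (l + 1) * (B ^ l * (B ^ (l + 1) * G ^ (l + 1))) := by
          nth_rw 1 [(hG.pow_pow l (l + 1)).eq]
          rw [pow_succ' B]
          simp only [mul_assoc]
      _ = B ^ l * G ^ (l + 1) := by rw [h2, (hG.pow_pow l (l + 1)).eq]
  · rw [← mul_assoc, ← pow_add, add_comm (l + 1), pow_add, mul_assoc, h2]

variable {A : Matrix (Fin m) (Fin n) ℍ[ℝ]} {W : Matrix (Fin n) (Fin m) ℍ[ℝ]}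

theorem IsWeightedDrazin.isDrazin {X : Matrix (Fin m) (Fin n) ℍ[ℝ]} (h : IsWeightedDrazin A W X) :
    IsDrazin (A * W) (ind (A * W)) (X * W) := by
  obtain ⟨h1, h2, h3⟩ := h
  refine ⟨?_, ?_, ?_⟩
  · show A * W * (X * W) = X * W * (A * W)
    rw [← Matrix.mul_assoc, h3, Matrix.mul_assoc _ A]
  · rw [← Matrix.mul_assoc, ← Matrix.mul_assoc, ← Matrix.mul_assoc, h2]
  · rw [← Matrix.mul_assoc, h1]

theorem IsWeightedDrazin.eq_mul {X : Matrix (Fin m) (Fin n) ℍ[ℝ]} (h : IsWeightedDrazin A W X) :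
    X = X * W * (X * W) * A := by
  obtain ⟨h1, h2, h3⟩ := h
  calc X = X * W * (A * W * X) := by rw [← Matrix.mul_assoc, ← Matrix.mul_assoc, h2]
    _ = _ := by rw [h3, ← Matrix.mul_assoc]

variable (A W) in
-- XW must be the Drazin inverse Y of AW, and X is recovered as YYA, so existence and uniqueness
-- both reduce to those of Y.
theorem existsUnique_isWeightedDrazin : ∃! X, IsWeightedDrazin A W X := by
  obtain ⟨Y, hY⟩ := exists_isDrazin (A * W)
  have hXW : Y * Y * A * W = Y := by
    rw [Matrix.mul_assoc _ A, Matrix.mul_assoc, ← hY.comm.eq, hY.mul_mul]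
  have hBX : A * W * (Y * Y * A) = Y * A := by
    rw [← Matrix.mul_assoc, ← Matrix.mul_assoc, hY.comm.eq, Matrix.mul_assoc Y, hY.mul_mul]
  refine ⟨Y * Y * A, ⟨?_, ?_, ?_⟩, ?_⟩
  · rw [Matrix.mul_assoc, hXW, hY.pow_mul]
  · rw [hXW, Matrix.mul_assoc Y, Matrix.mul_assoc Y, hBX, ← Matrix.mul_assoc]
  · rw [hXW, hBX]
  · intro X hX
    rw [hX.eq_mul, hX.isDrazin.eq hY]

theorem isWeightedDrazin_wDrazin (A : Matrix (Fin m) (Fin n) ℍ[ℝ])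
    (W : Matrix (Fin n) (Fin m) ℍ[ℝ]) : IsWeightedDrazin A W (wDrazin A W) := by
  have h := (existsUnique_isWeightedDrazin A W).exists
  rw [wDrazin, dif_pos h]
  exact h.choose_spec

end Drazin

/-! ### Numerators as multiples of the weighted CMP inverse -/

section Representation

open scoped Quaternion

variable {m n : ℕ}

/-- H is a left multiple of H², so all positive powers have the same rank. Thus r₁, given as the
rank of the k-th power, is the correct minor size for the power k + 2. -/
theorem rk_pow_add_two {H : Matrix (Fin n) (Fin n) ℍ[ℝ]} (hH : H.IsHermitian) {k : ℕ} (hk : 0 < k) :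
    rk (H ^ (k + 2)) = rk (H ^ k) := by
  have h0 := re_minorSum_rk_ne_zero hH
  have h1 := mul_mul_cofSum_rk hH
  have hc := commute_cofSum hH (Commute.refl H) (rk H)
  have h2 : ((minorSum H (rk H)).re⁻¹ • cofSum H (rk H)) * (H * H) = H := by
    rw [smul_mul_assoc, ← (hc.mul_left hc).eq, mul_assoc, h1, smul_smul, inv_mul_cancel₀ h0,
      one_smul]
  have h3 : ∀ s, rk (H ^ (s + 1 + 1)) = rk (H ^ (s + 1)) := fun s =>
    rk_eq_of_mul_eq (Y := H) (pow_succ' H (s + 1)).symm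
      (Z := (minorSum H (rk H)).re⁻¹ • cofSum H (rk H)) (by
        rw [pow_succ', pow_succ', ← mul_assoc H, ← mul_assoc, h2])
  obtain ⟨s, rfl⟩ := Nat.exists_eq_succ_of_ne_zero hk.ne'
  rw [Nat.succ_eq_add_one, h3 (s + 1), h3 s]

/-- Multiply KMK = dK on the right by T: the right side becomes dE, the left side KME = MKE = MK =
KM. -/
theorem mul_cofSum_rk_of_mul_eq {K E T : Matrix (Fin n) (Fin n) ℍ[ℝ]} (hK : K.IsHermitian)
    (hKE : K * E = K) (hET : K * T = E) :
    K * cofSum K (rk K) = (minorSum K (rk K)).re • E := by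
  have hc := (commute_cofSum hK (Commute.refl K) (rk K)).eq
  calc K * cofSum K (rk K) = cofSum K (rk K) * K * (K * T) := by rw [hET, mul_assoc, hKE, hc]
    _ = K * (K * cofSum K (rk K)) * T := by rw [← hc, ← mul_assoc, mul_assoc K (cofSum K _), ← hc]
    _ = _ := by rw [mul_mul_cofSum_rk hK, smul_mul_assoc, hET]

theorem pow_mul_comm_mul (A : Matrix (Fin m) (Fin n) ℍ[ℝ]) (W : Matrix (Fin n) (Fin m) ℍ[ℝ])
    (s : ℕ) : (W * A) ^ s * W = W * (A * W) ^ s := by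
  induction s with
  | zero => rw [pow_zero, pow_zero, Matrix.one_mul, Matrix.mul_one]
  | succ s ih =>
    rw [pow_succ, pow_succ, Matrix.mul_assoc, Matrix.mul_assoc, ← Matrix.mul_assoc, ih]
    simp only [Matrix.mul_assoc]

variable (A : Matrix (Fin m) (Fin n) ℍ[ℝ]) (W : Matrix (Fin n) (Fin m) ℍ[ℝ]) {k : ℕ}

theorem wcmp_eq : wcmp A W = mpInv A * A * (W * (wDrazin A W * W) * A) * mpInv A := by
  simp only [wcmp, Matrix.mul_assoc]

theorem pow_mul_cofSum_left (hk : ind (A * W) ≤ k) (hWA : (W * A).IsHermitian) :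
    (W * A) ^ (k + 2) * cofSum ((W * A) ^ (k + 2)) (rk ((W * A) ^ (k + 2))) =
      (minorSum ((W * A) ^ (k + 2)) (rk ((W * A) ^ (k + 2)))).re • (W * (wDrazin A W * W) * A) := by
  -- At the bound k + 1 the Drazin equation reads (AW)^(k+2) Y = (AW)^(k+1); the lost factor is
  -- restored by the outer W and A.
  have hY := (isWeightedDrazin_wDrazin A W).isDrazin.mono (hk.trans (Nat.le_succ k))
  refine mul_cofSum_rk_of_mul_eq (T := W * (wDrazin A W * W) ^ (k + 2 + 1) * A) (hWA.pow _) ?_ ?_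
  · rw [← Matrix.mul_assoc, ← Matrix.mul_assoc, pow_mul_comm_mul, Matrix.mul_assoc W, hY.pow_mul,
      ← pow_mul_comm_mul, Matrix.mul_assoc, ← pow_succ]
  · rw [← Matrix.mul_assoc, ← Matrix.mul_assoc, pow_mul_comm_mul, Matrix.mul_assoc W,
      hY.pow_mul_pow]

theorem pow_mul_cofSum_right (hk : ind (A * W) ≤ k) (hAW : (A * W).IsHermitian) :
    (A * W) ^ (k + 2) * cofSum ((A * W) ^ (k + 2)) (rk ((A * W) ^ (k + 2))) =
      (minorSum ((A * W) ^ (k + 2)) (rk ((A * W) ^ (k + 2)))).re • (A * W * (wDrazin A W * W)) := by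
  have hY := (isWeightedDrazin_wDrazin A W).isDrazin.mono (hk.trans (Nat.le_add_right k 2))
  refine mul_cofSum_rk_of_mul_eq (T := (wDrazin A W * W) ^ (k + 2)) (hAW.pow _) ?_ ?_
  · rw [← mul_assoc, ← pow_succ, hY.pow_mul]
  · rw [pow_succ' (A * W), mul_assoc, hY.pow_mul_pow]

theorem rdetSums_eq_smul_wcmp (hk : ind (A * W) ≤ k) (hk0 : 0 < k) (hWA : (W * A).IsHermitian) :
    rdetSums (A * Aᴴ) (rk A) (rdetSums ((W * A) ^ (k + 2)) (rk ((W * A) ^ k))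
      (cdetSums (Aᴴ * A) (rk A) (Aᴴ * A * W) * A * (W * A) ^ k) * W * A * Aᴴ) =
      ((minorSum (Aᴴ * A) (rk A)).re ^ 2 *
        (minorSum ((W * A) ^ (k + 2)) (rk ((W * A) ^ k))).re) • wcmp A W := by
  have h1 := pow_mul_cofSum_left A W hk hWA
  rw [rk_pow_add_two hWA hk0] at h1
  have h2 := (commute_cofSum (hWA.pow (k + 2)) ((Commute.refl (W * A)).pow_right (k + 2))
    (rk ((W * A) ^ k))).eq
  rw [cdetSums_eq_mul (Matrix.isHermitian_conjTranspose_mul_self A), rdetSums_eq_mul,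
    rdetSums_eq_mul]
  generalize cofSum ((W * A) ^ (k + 2)) (rk ((W * A) ^ k)) = N at *
  -- Each Gram matrix is grouped with its own cofactor sum.
  calc _ = cofSum (Aᴴ * A) (rk A) * (Aᴴ * A) * ((W * A * (W * A) ^ k) * N * W) *
        (A * Aᴴ * cofSum (A * Aᴴ) (rk A)) := by simp only [Matrix.mul_assoc]
    _ = ((minorSum (Aᴴ * A) (rk A)).re * (minorSum (Aᴴ * A) (rk A)).re) •
        (mpInv A * A * (((W * A) ^ (k + 1)) * (N * (W * A))) * mpInv A) := by
        rw [cofSum_gram_mul, mul_cofSum_mul_conjTranspose, ← pow_succ']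
        simp only [Matrix.mul_assoc, Matrix.mul_smul, Matrix.smul_mul, smul_smul]
    _ = _ := by
        -- The last W and the A of AA† form one more WA; N commutes with it, and the power reaches k
        -- + 2.
        rw [← h2, ← mul_assoc ((W * A) ^ (k + 1)), ← pow_succ, h1, wcmp_eq]
        simp only [Matrix.mul_smul, Matrix.smul_mul, smul_smul]
        rw [sq]

theorem cdetSums_eq_smul_wcmp (hk : ind (A * W) ≤ k) (hk0 : 0 < k) (hAW : (A * W).IsHermitian) :
    cdetSums (Aᴴ * A) (rk A) (Aᴴ * A * W * cdetSums ((A * W) ^ (k + 2)) (rk ((A * W) ^ k))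
      ((A * W) ^ k * A * rdetSums (A * Aᴴ) (rk A) (W * A * Aᴴ))) =
      ((minorSum (Aᴴ * A) (rk A)).re ^ 2 *
        (minorSum ((A * W) ^ (k + 2)) (rk ((A * W) ^ k))).re) • wcmp A W := by
  have h1 := pow_mul_cofSum_right A W hk hAW
  rw [rk_pow_add_two hAW hk0] at h1
  have h2 := (commute_cofSum (hAW.pow (k + 2)) ((Commute.refl (A * W)).pow_right (k + 2))
    (rk ((A * W) ^ k))).eq
  have h3 := ((commute_cofSum (hAW.pow (k + 2)) ((Commute.refl (A * W)).pow_right (k + 2))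
    (rk ((A * W) ^ k))).pow_left (k + 1)).eq
  rw [cdetSums_eq_mul (Matrix.isHermitian_conjTranspose_mul_self A), rdetSums_eq_mul,
    cdetSums_eq_mul (hAW.pow _)]
  generalize cofSum ((A * W) ^ (k + 2)) (rk ((A * W) ^ k)) = N at *
  calc _ = cofSum (Aᴴ * A) (rk A) * (Aᴴ * A) * (W * N * ((A * W) ^ k * (A * W))) *
        (A * Aᴴ * cofSum (A * Aᴴ) (rk A)) := by simp only [Matrix.mul_assoc]
    _ = ((minorSum (Aᴴ * A) (rk A)).re * (minorSum (Aᴴ * A) (rk A)).re) •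
        (mpInv A * (A * W * (N * (A * W) ^ (k + 1))) * A * mpInv A) := by
        rw [cofSum_gram_mul, mul_cofSum_mul_conjTranspose, ← pow_succ]
        simp only [Matrix.mul_assoc, Matrix.mul_smul, Matrix.smul_mul, smul_smul]
    _ = _ := by
        -- The power (AW)^(k+1) moves left past N and joins the AW whose A comes from A†A.
        rw [← h3, ← mul_assoc (A * W), ← pow_succ', h1, wcmp_eq]
        simp only [Matrix.mul_assoc, Matrix.mul_smul, Matrix.smul_mul, smul_smul]
        rw [sq]

theorem coe_smul_div_cancel {t : ℝ} (ht : t ≠ 0) (x : ℍ[ℝ]) : t • x / (t : ℍ[ℝ]) = x := by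
  have h : (t : ℍ[ℝ]) ≠ 0 := fun h => ht (Quaternion.coe_injective (h.trans Quaternion.coe_zero.symm))
  rw [← Quaternion.mul_coe_eq_smul, mul_div_cancel_right₀ _ h]

theorem minorSum_rk_ne_zero {H : Matrix (Fin n) (Fin n) ℍ[ℝ]} (hH : H.IsHermitian) :
    minorSum H (rk H) ≠ 0 := fun h => re_minorSum_rk_ne_zero hH (by rw [h]; rfl)

end Representation

end QuatMat

/-! ### The determinantal formulas -/

theorem theorem5p4 {m n : ℕ} (A : Matrix (Fin m) (Fin n) (Quaternion ℝ))
    (W : Matrix (Fin n) (Fin m) (Quaternion ℝ)) (hW : W ≠ 0)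
    (r : ℕ) (hr : rk A = r) (k : ℕ) (hk : k = max (ind (W * A)) (ind (A * W))) :
    (∃! X, IsMoorePenrose A X) ∧ (∃! X, IsWeightedDrazin A W X) ∧
    (∀ r₁ : ℕ, (W * A).IsHermitian → rk ((W * A) ^ k) = r₁ →
      let Φ := cdetSums (Aᴴ * A) r (Aᴴ * A * W)
      let Φ₁ := Φ * A * (W * A) ^ k
      let Ω := rdetSums ((W * A) ^ (k + 2)) r₁ Φ₁
      let Ωt := Ω * W * A * Aᴴ
      minorSum (Aᴴ * A) r ≠ 0 ∧ minorSum ((W * A) ^ (k + 2)) r₁ ≠ 0 ∧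
      ∀ (i : Fin n) (j : Fin m), wcmp A W i j =
        rdetSums (A * Aᴴ) r Ωt i j /
          (minorSum (Aᴴ * A) r ^ 2 * minorSum ((W * A) ^ (k + 2)) r₁)) ∧
    (∀ r₁ : ℕ, (A * W).IsHermitian → rk ((A * W) ^ k) = r₁ →
      let Ψ := rdetSums (A * Aᴴ) r (W * A * Aᴴ)
      let Ψ₁ := (A * W) ^ k * A * Ψ
      let Υ := cdetSums ((A * W) ^ (k + 2)) r₁ Ψ₁
      let Υt := Aᴴ * A * W * Υ
      minorSum (A * Aᴴ) r ≠ 0 ∧ minorSum ((A * W) ^ (k + 2)) r₁ ≠ 0 ∧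
      ∀ (i : Fin n) (j : Fin m), wcmp A W i j =
        cdetSums (Aᴴ * A) r Υt i j /
          (minorSum (A * Aᴴ) r ^ 2 * minorSum ((A * W) ^ (k + 2)) r₁)) := by
  subst hr
  have hk1 : ind (A * W) ≤ k := hk ▸ le_max_right _ _
  have hk0 : 0 < k := (ind_spec (A * W)).1.trans_le hk1
  have hH := Matrix.isHermitian_conjTranspose_mul_self A
  have hd : minorSum (Aᴴ * A) (rk A) ≠ 0 := by
    have := minorSum_rk_ne_zero hH
    rwa [rk_conjTranspose_mul] at this
  have hd' : (minorSum (Aᴴ * A) (rk A)).re ≠ 0 := by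
    have := re_minorSum_rk_ne_zero hH
    rwa [rk_conjTranspose_mul] at this
  refine ⟨?_, existsUnique_isWeightedDrazin A W, ?_, ?_⟩
  · obtain ⟨X, hX⟩ := exists_isMoorePenrose A
    exact ⟨X, hX, fun Y hY => hY.eq hX⟩
  · rintro r₁ hWA rfl
    have hK := hWA.pow (k + 2)
    have h0 := minorSum_rk_ne_zero hK
    have h0' := re_minorSum_rk_ne_zero hK
    rw [rk_pow_add_two hWA hk0] at h0 h0'
    refine ⟨hd, h0, fun i j => ?_⟩
    rw [rdetSums_eq_smul_wcmp A W hk1 hk0 hWA, minorSum_eq_coe hH, minorSum_eq_coe hK,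
      ← Quaternion.coe_pow, ← Quaternion.coe_mul, Matrix.smul_apply]
    exact (coe_smul_div_cancel (mul_ne_zero (pow_ne_zero 2 hd') h0') _).symm
  · rintro r₁ hAW rfl
    have hK := hAW.pow (k + 2)
    have h0 := minorSum_rk_ne_zero hK
    have h0' := re_minorSum_rk_ne_zero hK
    rw [rk_pow_add_two hAW hk0] at h0 h0'
    -- The denominator of (ii) is written with AAᴴ, which has the same minor sums as AᴴA.
    rw [← minorSum_gram]
    refine ⟨hd, h0, fun i j => ?_⟩
    rw [cdetSums_eq_smul_wcmp A W hk1 hk0 hAW, minorSum_eq_coe hH, minorSum_eq_coe hK,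
      ← Quaternion.coe_pow, ← Quaternion.coe_mul, Matrix.smul_apply]
    exact (coe_smul_div_cancel (mul_ne_zero (pow_ne_zero 2 hd') h0') _).symm
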